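/- Let $m\ge 0$, let $x=(x_1,\dots,x_m)\in\mathbb C^m$ be such that $x_0=0,\;x_1,\dots,x_m,\;x_{m+1}=1$ are pairwise distinct, put $x_{m+2}=\infty$ and $T_x=\mathbb C\setminus\{0,x_1,\dots,x_m,1\}$. Let $\alpha=(\alpha_0,\dots,\alpha_{m+2})\in\mathbb C^{m+3}$ with $\sum_{i=0}^{m+2}\alpha_i=0$, and let $i_m,i_{m+1},i_{m+2}$ be three distinct elements of $\{0,\dots,m+2\}$ with $$\alpha_{i_m},\ \alpha_{i_{m+1}},\ \alpha_{i_{m+2}}\notin\mathbb Z,\qquad \alpha_{i_{m+1}}+\alpha_{i_{m+2}}\neq 0.$$ Put $\hat\alpha=\alpha+e_{i_{m+1}}+e_{i_{m+2}}-e_{m+1}-e_{m+2}$, where $e_0,\dots,e_{m+2}$ are the unit vectors of $\mathbb C^{m+3}$, and assume that $\hat\alpha_i\notin\{-1,-2,-3,\dots\}$ for $0\le i\le m+2$. Let $$\hat\omega=\sum_{i=0}^{m+1}\frac{\hat\alpha_i\,dt}{t-x_i},\qquad \varphi=\frac{dt}{t-x_{i_{m+1}}}-\frac{dt}{t-x_{i_{m+2}}},$$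 where $dt/(t-\infty)$ is read as $0$. For a closed holomorphic $1$-form $\kappa$ on $T_x$ let $\nabla_\kappa=d+\kappa\wedge$, and let $$H^1(T_x,\nabla_\kappa)=\frac{\ker(\nabla_\kappa:\mathcal E^1(T_x)\to\mathcal E^2(T_x))}{\nabla_\kappa(\mathcal E^0(T_x))},\qquad H^1_c(T_x,\nabla_\kappa)=\frac{\ker(\nabla_\kappa:\mathcal E^1_c(T_x)\to\mathcal E^2_c(T_x))}{\nabla_\kappa(\mathcal E^0_c(T_x))},$$ where $\mathcal E^k(T_x)$ and $\mathcal E^k_c(T_x)$ are the spaces of complex-valued smooth $k$-forms on $T_x$ and of those with compact support in $T_x$. Then $\varphi$ represents a non-zero element of both $H^1_c(T_x,\nabla_{\hat\omega})$ and $H^1(T_x,\nabla_{-\hat\omega})$, and the corresponding intersection number is as given below. That is: 1. The class $[\varphi]\in H^1(T_x,\nabla_{-\hat\omega})$ is non-zero. 2. Call $\varphi_c$ a compact representative of $\varphi$ if it is a $\nabla_{\hat\omega}$-closed form in $\mathcal E^1_c(T_x)$ with $\varphi_c=\varphi-\nabla_{\hat\omega}f$, where $f\in\mathcal E^0(T_x)$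 coincides near each of the points $0,x_1,\dots,x_m,1,\infty$ of $\mathbb P^1$ with a function that is holomorphic there, this point included. Then compact representatives exist, and for each of them the class $[\varphi_c]\in H^1_c(T_x,\nabla_{\hat\omega})$ is non-zero and is mapped to $[\varphi]$ by the natural map $H^1_c(T_x,\nabla_{\hat\omega})\to H^1(T_x,\nabla_{\hat\omega})$. 3. For each compact representative $\varphi_c$ the intersection number $\langle[\varphi_c],[\varphi]\rangle=\int_{T_x}\xi_c\wedge\eta$, computed with any representatives $\xi_c$ of $[\varphi_c]\in H^1_c(T_x,\nabla_{\hat\omega})$ and $\eta$ of $[\varphi]\in H^1(T_x,\nabla_{-\hat\omega})$, and with the standard orientation of $\mathbb C$, is $$\langle[\varphi_c],[\varphi]\rangle=2\pi\sqrt{-1}\,\frac{\hat\alpha_{i_{m+1}}+\hat\alpha_{i_{m+2}}}{\hat\alpha_{i_{m+1}}\,\hat\alpha_{i_{m+2}}}.$$ -/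

import Mathlib

open Filter MeasureTheory TopologicalSpace
open scoped ContDiff Topology

noncomputable section

namespace TwistedCohomology

/-! ### Complex-valued smooth forms on an open subset of `ℂ = ℝ²` -/

section

variable (T : Opens ℂ) (V : Type) [NormedAddCommGroup V] [NormedSpace ℝ V] [NormedSpace ℂ V]
  [SMulCommClass ℝ ℂ V]

/-- Smooth maps `T → V` on an open set `T ⊆ ℂ = ℝ²`, as a complex vector space. Such a map is
identified with its extension by zero to `ℂ`. -/
def smoothSubmodule : Submodule ℂ (ℂ → V) where
  carrier := {η | ContDiffOn ℝ ∞ η T ∧ ∀ z ∉ T, η z = 0}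
  zero_mem' := ⟨contDiffOn_const, fun _ _ => rfl⟩
  add_mem' := fun ha hb => ⟨ha.1.add hb.1, fun z hz => by simp [ha.2 z hz, hb.2 z hz]⟩
  smul_mem' := fun c _ ha => ⟨ha.1.const_smul c, fun z hz => by simp [ha.2 z hz]⟩

/-- The type of smooth maps `T → V`. -/
def Smooth : Type := smoothSubmodule T V

instance : AddCommGroup (Smooth T V) := inferInstanceAs (AddCommGroup (smoothSubmodule T V))

instance : Module ℂ (Smooth T V) := inferInstanceAs (Module ℂ (smoothSubmodule T V))

variable {T V}

@[ext]
theorem Smooth.ext {a b : Smooth T V} (h : ∀ z, a.1 z = b.1 z) : a = b :=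
  Subtype.ext (funext h)

/-- A smooth map on `T`, from a function that is smooth on `T` and zero outside `T`. -/
def Smooth.mk (η : ℂ → V) (h : ContDiffOn ℝ ∞ η T) (h0 : ∀ z ∉ T, η z = 0) : Smooth T V :=
  ⟨η, h, h0⟩

@[simp]
theorem Smooth.mk_val (η : ℂ → V) (h : ContDiffOn ℝ ∞ η T) (h0 : ∀ z ∉ T, η z = 0) :
    (Smooth.mk η h h0).1 = η := rfl

@[simp]
theorem Smooth.zero_val : (0 : Smooth T V).1 = 0 := rfl

@[simp]
theorem Smooth.add_val (a b : Smooth T V) : (a + b).1 = a.1 + b.1 := rfl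

@[simp]
theorem Smooth.smul_val (c : ℂ) (a : Smooth T V) : (c • a).1 = c • a.1 := rfl

theorem Smooth.differentiableAt (η : Smooth T V) {z : ℂ} (hz : z ∈ T) :
    DifferentiableAt ℝ η.1 z :=
  (η.2.1.differentiableOn (by simp)).differentiableAt (T.isOpen.mem_nhds hz)

theorem Smooth.contDiffOn_fderiv (η : Smooth T V) : ContDiffOn ℝ ∞ (fderiv ℝ η.1) T :=
  η.2.1.fderiv_of_isOpen T.isOpen (by simp)

theorem Smooth.fderiv_eq_zero {η : Smooth T V} {K : Set ℂ} (hK : IsCompact K)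
    (h : ∀ z ∉ K, η.1 z = 0) {z : ℂ} (hz : z ∉ K) : fderiv ℝ η.1 z = 0 := by
  have h0 : η.1 =ᶠ[𝓝 z] fun _ => 0 := by
    filter_upwards [hK.isClosed.isOpen_compl.mem_nhds hz] with w hw using h w hw
  rw [h0.fderiv_eq]
  simp

variable (T V)

/-- The maps in `Smooth T V` with compact support in `T`. -/
def SmoothC : Submodule ℂ (Smooth T V) where
  carrier := {η | ∃ K : Set ℂ, IsCompact K ∧ K ⊆ T ∧ ∀ z ∉ K, η.1 z = 0}
  zero_mem' := ⟨∅, isCompact_empty, Set.empty_subset _, fun _ _ => rfl⟩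
  add_mem' := by
    rintro a b ⟨K, hK, hKT, ha⟩ ⟨L, hL, hLT, hb⟩
    refine ⟨K ∪ L, hK.union hL, Set.union_subset hKT hLT, fun z hz => ?_⟩
    rw [Set.mem_union, not_or] at hz
    simp [ha z hz.1, hb z hz.2]
  smul_mem' := by
    rintro c a ⟨K, hK, hKT, ha⟩
    exact ⟨K, hK, hKT, fun z hz => by simp [ha z hz]⟩

end

/-- `E^0(T)`: complex-valued smooth functions on `T`. -/
abbrev E0 (T : Opens ℂ) : Type := Smooth T ℂ

/-- `E^1(T)`: complex-valued smooth `1`-forms `P dx + Q dy` on `T`, where `t = x + i y`, given by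
the pair of coefficients `(P, Q)`. -/
abbrev E1 (T : Opens ℂ) : Type := Smooth T (ℂ × ℂ)

/-- `E^2(T)`: complex-valued smooth `2`-forms `h dx ∧ dy` on `T`, given by the coefficient `h`. -/
abbrev E2 (T : Opens ℂ) : Type := Smooth T ℂ

/-- `E_c^0(T)`: functions in `E^0(T)` with compact support in `T`. -/
abbrev E0c (T : Opens ℂ) : Submodule ℂ (E0 T) := SmoothC T ℂ

/-- `E_c^1(T)`: `1`-forms in `E^1(T)` with compact support in `T`. -/
abbrev E1c (T : Opens ℂ) : Submodule ℂ (E1 T) := SmoothC T (ℂ × ℂ)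

/-- `E_c^2(T)`: `2`-forms in `E^2(T)` with compact support in `T`. -/
abbrev E2c (T : Opens ℂ) : Submodule ℂ (E2 T) := SmoothC T ℂ

/-- The wedge product of the covectors `θ = (P, Q)` and `η = (P', Q')`, as a coefficient of
`dx ∧ dy`: `(P dx + Q dy) ∧ (P' dx + Q' dy) = (P Q' - Q P') dx ∧ dy`. -/
def wedge (θ η : ℂ × ℂ) : ℂ := θ.1 * η.2 - θ.2 * η.1

/-- The exterior derivative `df = ∂f/∂x dx + ∂f/∂y dy` of a function. -/
def d0 (f : ℂ → ℂ) (z : ℂ) : ℂ × ℂ := (fderiv ℝ f z 1, fderiv ℝ f z Complex.I)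

/-- The exterior derivative `d(P dx + Q dy) = (∂Q/∂x - ∂P/∂y) dx ∧ dy` of a `1`-form, as a
coefficient of `dx ∧ dy`. -/
def d1 (η : ℂ → ℂ × ℂ) (z : ℂ) : ℂ := (fderiv ℝ η z 1).2 - (fderiv ℝ η z Complex.I).1

open scoped Classical in
/-- The form `df + f κ` on `T`. -/
def nabla0Fun {T : Opens ℂ} (κ : E1 T) (f : E0 T) : E1 T :=
  .mk (fun z => if z ∈ T then d0 f.1 z + f.1 z • κ.1 z else 0) (by
    refine ContDiffOn.congr ?_ fun z hz => if_pos hz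
    have h := Smooth.contDiffOn_fderiv f
    have h1 := f.2.1
    have h2 := κ.2.1
    unfold d0
    fun_prop) fun z hz => if_neg hz

open scoped Classical in
/-- The form `dη + κ ∧ η` on `T`. -/
def nabla1Fun {T : Opens ℂ} (κ η : E1 T) : E2 T :=
  .mk (fun z => if z ∈ T then d1 η.1 z + wedge (κ.1 z) (η.1 z) else 0) (by
    refine ContDiffOn.congr ?_ fun z hz => if_pos hz
    have h := Smooth.contDiffOn_fderiv η
    have h1 := η.2.1
    have h2 := κ.2.1
    unfold d1 wedge
    fun_prop) fun z hz => if_neg hz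

/-- The twisted exterior derivative `∇_κ = d + κ ∧ : E^0(T) → E^1(T)`. -/
def nabla0 {T : Opens ℂ} (κ : E1 T) : E0 T →ₗ[ℂ] E1 T where
  toFun := nabla0Fun κ
  map_add' a b := by
    ext1 z
    by_cases hz : z ∈ T
    · ext <;> simp [nabla0Fun, hz, d0, fderiv_add (a.differentiableAt hz) (b.differentiableAt hz)]
        <;> ring
    · simp [nabla0Fun, hz]
  map_smul' c a := by
    ext1 z
    by_cases hz : z ∈ T
    · ext <;> simp [nabla0Fun, hz, d0, fderiv_const_smul (a.differentiableAt hz)] <;> ring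
    · simp [nabla0Fun, hz]

/-- The twisted exterior derivative `∇_κ = d + κ ∧ : E^1(T) → E^2(T)`. -/
def nabla1 {T : Opens ℂ} (κ : E1 T) : E1 T →ₗ[ℂ] E2 T where
  toFun := nabla1Fun κ
  map_add' a b := by
    ext1 z
    by_cases hz : z ∈ T
    · simp [nabla1Fun, hz, d1, wedge,
        fderiv_add (a.differentiableAt hz) (b.differentiableAt hz)]
      ring
    · simp [nabla1Fun, hz]
  map_smul' c a := by
    ext1 z
    by_cases hz : z ∈ T
    · simp [nabla1Fun, hz, d1, wedge, fderiv_const_smul (a.differentiableAt hz)]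
      ring
    · simp [nabla1Fun, hz]

theorem nabla0_mem {T : Opens ℂ} (κ : E1 T) : ∀ f ∈ E0c T, nabla0 κ f ∈ E1c T := by
  rintro f ⟨K, hK, hKT, h⟩
  refine ⟨K, hK, hKT, fun z hz => ?_⟩
  simp [nabla0, nabla0Fun, d0, Smooth.fderiv_eq_zero hK h hz, h z hz]

theorem nabla1_mem {T : Opens ℂ} (κ : E1 T) : ∀ η ∈ E1c T, nabla1 κ η ∈ E2c T := by
  rintro η ⟨K, hK, hKT, h⟩
  refine ⟨K, hK, hKT, fun z hz => ?_⟩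
  simp [nabla1, nabla1Fun, d1, wedge, Smooth.fderiv_eq_zero hK h hz, h z hz]

/-- The twisted exterior derivative `∇_κ : E_c^0(T) → E_c^1(T)`. -/
def nabla0c {T : Opens ℂ} (κ : E1 T) : E0c T →ₗ[ℂ] E1c T := (nabla0 κ).restrict (nabla0_mem κ)

/-- The twisted exterior derivative `∇_κ : E_c^1(T) → E_c^2(T)`. -/
def nabla1c {T : Opens ℂ} (κ : E1 T) : E1c T →ₗ[ℂ] E2c T := (nabla1 κ).restrict (nabla1_mem κ)

/-! ### Twisted cohomology groups of degree one -/

/-- The closed forms `ker(∇_κ : E^1(T) → E^2(T))`. -/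
abbrev Z1 {T : Opens ℂ} (κ : E1 T) : Submodule ℂ (E1 T) := (nabla1 κ).ker

/-- The closed compactly supported forms `ker(∇_κ : E_c^1(T) → E_c^2(T))`. -/
abbrev Z1c {T : Opens ℂ} (κ : E1 T) : Submodule ℂ (E1c T) := (nabla1c κ).ker

/-- The exact forms `∇_κ(E^0(T))`, inside the closed forms. -/
abbrev B1 {T : Opens ℂ} (κ : E1 T) : Submodule ℂ (Z1 κ) := (nabla0 κ).range.submoduleOf (Z1 κ)

/-- The forms `∇_κ(E_c^0(T))`, inside the closed compactly supported forms. -/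
abbrev B1c {T : Opens ℂ} (κ : E1 T) : Submodule ℂ (Z1c κ) :=
  (nabla0c κ).range.submoduleOf (Z1c κ)

/-- The twisted cohomology group `H^1(T, ∇_κ)`. -/
abbrev H1 {T : Opens ℂ} (κ : E1 T) : Type := Z1 κ ⧸ B1 κ

/-- The twisted cohomology group with compact support `H^1_c(T, ∇_κ)`. -/
abbrev H1c {T : Opens ℂ} (κ : E1 T) : Type := Z1c κ ⧸ B1c κ

/-- The class of a closed form in `H^1(T, ∇_κ)`. -/
abbrev cls {T : Opens ℂ} {κ : E1 T} (η : Z1 κ) : H1 κ := (B1 κ).mkQ η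

/-- The class of a closed compactly supported form in `H^1_c(T, ∇_κ)`. -/
abbrev clsC {T : Opens ℂ} {κ : E1 T} (ψ : Z1c κ) : H1c κ := (B1c κ).mkQ ψ

/-- The inclusion of closed compactly supported forms into closed forms. -/
def inclZ {T : Opens ℂ} (κ : E1 T) : Z1c κ →ₗ[ℂ] Z1 κ :=
  ((E1c T).subtype.comp (Z1c κ).subtype).codRestrict (Z1 κ) fun ψ =>
    congrArg Subtype.val (LinearMap.mem_ker.mp ψ.2)

theorem B1c_le {T : Opens ℂ} (κ : E1 T) : B1c κ ≤ (B1 κ).comap (inclZ κ) := by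
  rintro ψ ⟨g, hg⟩
  exact ⟨g.1, congrArg Subtype.val hg⟩

/-- The natural map `H^1_c(T, ∇_κ) → H^1(T, ∇_κ)` induced by the inclusion of forms. -/
def natMap {T : Opens ℂ} (κ : E1 T) : H1c κ →ₗ[ℂ] H1 κ :=
  (B1c κ).mapQ (B1 κ) (inclZ κ) (B1c_le κ)

/-- The integral `∫_T ξ ∧ η` of the wedge product of two `1`-forms, for the standard orientation
of `T ⊆ ℂ`. -/
def pairing {T : Opens ℂ} (ξ η : E1 T) : ℂ := ∫ z in (T : Set ℂ), wedge (ξ.1 z) (η.1 z)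

/-! ### The punctured line and its logarithmic forms -/

/-- The finite points `(x_0, x_1, …, x_m, x_{m+1}) = (0, x_1, …, x_m, 1)`. -/
def pts {m : ℕ} (x : Fin m → ℂ) : Fin (m + 2) → ℂ :=
  Fin.cons 0 (Fin.snoc (α := fun _ => ℂ) x 1)

/-- `T_x = ℂ ∖ {0, x_1, …, x_m, 1}`. -/
def fiber {m : ℕ} (x : Fin m → ℂ) : Opens ℂ :=
  ⟨(Set.range (pts x))ᶜ, (Set.finite_range (pts x)).isClosed.isOpen_compl⟩

/-- The form `g(t) dt = g dx + i g dy` on `T` for a function `g` that is holomorphic on `T`. -/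
def holForm {T : Opens ℂ} (g : ℂ → ℂ) (hg : DifferentiableOn ℂ g T) : E1 T :=
  .mk ((T : Set ℂ).indicator fun z => (g z, g z * Complex.I))
    ((((hg.contDiffOn T.isOpen).restrict_scalars ℝ).prodMk
      (((hg.contDiffOn T.isOpen).restrict_scalars ℝ).mul contDiffOn_const)).congr
        fun _ hz => Set.indicator_of_mem hz _)
    fun _ hz => Set.indicator_of_notMem hz _

theorem differentiableOn_inv_sub {m : ℕ} (x : Fin m → ℂ) (i : Fin (m + 2)) :
    DifferentiableOn ℂ (fun t => (t - pts x i)⁻¹) (fiber x) := fun _ ht =>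
  ((differentiableAt_fun_id.sub_const (pts x i)).fun_inv
    (sub_ne_zero.mpr fun h => ht ⟨i, h.symm⟩)).differentiableWithinAt

/-- The form `dt / (t - x_i)` on `T_x` for `0 ≤ i ≤ m + 2`; as `x_{m+2} = ∞`, it is zero for
`i = m + 2`. -/
def dlog {m : ℕ} (x : Fin m → ℂ) (i : Fin (m + 3)) : E1 (fiber x) :=
  Fin.lastCases (motive := fun _ => E1 (fiber x)) 0
    (fun i => holForm (fun t => (t - pts x i)⁻¹) (differentiableOn_inv_sub x i)) i

/-- The form `ω = d log u = ∑_{0 ≤ i ≤ m+1} α_i dt / (t - x_i)` on `T_x`. -/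
def connForm {m : ℕ} (x : Fin m → ℂ) (α : Fin (m + 3) → ℂ) : E1 (fiber x) :=
  ∑ i : Fin (m + 2), α i.castSucc • dlog x i.castSucc

/-- The form `φ = dt / (t - x_q) - dt / (t - x_r)` on `T_x`. -/
def phi {m : ℕ} (x : Fin m → ℂ) (q r : Fin (m + 3)) : E1 (fiber x) := dlog x q - dlog x r

/-- The forms `g(t) dt` with `g` holomorphic on `T`. -/
def holForms (T : Opens ℂ) : Submodule ℂ (E1 T) where
  carrier := {η | ∃ (g : ℂ → ℂ) (hg : DifferentiableOn ℂ g T), η = holForm g hg}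
  zero_mem' := ⟨fun _ => 0, differentiableOn_const 0, by
    ext1 z; by_cases hz : z ∈ T <;> simp [holForm, hz, Prod.ext_iff]⟩
  add_mem' := by
    rintro _ _ ⟨g, hg, rfl⟩ ⟨f, hf, rfl⟩
    refine ⟨g + f, hg.add hf, ?_⟩
    ext1 z
    by_cases hz : z ∈ T <;> simp [holForm, hz, add_mul]
  smul_mem' := by
    rintro c _ ⟨g, hg, rfl⟩
    refine ⟨c • g, hg.const_smul c, ?_⟩
    ext1 z
    by_cases hz : z ∈ T <;> simp [holForm, hz, mul_assoc]

theorem dlog_mem {m : ℕ} (x : Fin m → ℂ) (i : Fin (m + 3)) : dlog x i ∈ holForms (fiber x) := by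
  induction i using Fin.lastCases with
  | last => simp [dlog]
  | cast i => exact ⟨_, differentiableOn_inv_sub x i, by simp [dlog]⟩

theorem holForms_le_Z1 {T : Opens ℂ} {κ : E1 T} (hκ : κ ∈ holForms T) :
    holForms T ≤ Z1 κ := by
  obtain ⟨g, hg, rfl⟩ := hκ
  rintro _ ⟨f, hf, rfl⟩
  rw [LinearMap.mem_ker]
  ext1 z
  by_cases hz : z ∈ T
  · have hfz : HasFDerivAt f (ContinuousLinearMap.smulRight (1 : ℂ →L[ℂ] ℂ) (deriv f z)) z :=
      (hf.differentiableAt (T.isOpen.mem_nhds hz)).hasDerivAt.hasFDerivAt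
    have h0 : (holForm f hf).1 =ᶠ[𝓝 z] fun z => (f z, f z * Complex.I) := by
      filter_upwards [T.isOpen.mem_nhds hz] with w hw
      exact Set.indicator_of_mem (s := (T : Set ℂ)) hw fun z => (f z, f z * Complex.I)
    have h1 := (hfz.restrictScalars ℝ).prodMk ((hfz.restrictScalars ℝ).mul_const Complex.I)
    have h2 : d1 (holForm f hf).1 z = 0 := by
      rw [d1, h0.fderiv_eq, h1.fderiv]
      simp [mul_comm]
    have h3 : wedge ((holForm g hg).1 z) ((holForm f hf).1 z) = 0 := by
      simp [holForm, hz, wedge]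
      ring
    simp [nabla1, nabla1Fun, hz, h2, h3]
  · simp [nabla1, nabla1Fun, hz]

theorem connForm_mem {m : ℕ} (x : Fin m → ℂ) (α : Fin (m + 3) → ℂ) :
    connForm x α ∈ holForms (fiber x) :=
  Submodule.sum_mem _ fun _ _ => Submodule.smul_mem _ _ (dlog_mem x _)

theorem phi_mem {m : ℕ} (x : Fin m → ℂ) (q r : Fin (m + 3)) : phi x q r ∈ holForms (fiber x) :=
  Submodule.sub_mem _ (dlog_mem x q) (dlog_mem x r)

/-- The form `φ`, as a closed form for `∇_κ` with `κ = ∑ α_i dt / (t - x_i)`. -/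
def phiZ {m : ℕ} (x : Fin m → ℂ) (α : Fin (m + 3) → ℂ) (q r : Fin (m + 3)) :
    Z1 (connForm x α) :=
  ⟨phi x q r, holForms_le_Z1 (connForm_mem x α) (phi_mem x q r)⟩

/-- The shifted parameters `α̂ = α + e_q + e_r - e_{m+1} - e_{m+2}`. -/
def shift {m : ℕ} (α : Fin (m + 3) → ℂ) (q r : Fin (m + 3)) : Fin (m + 3) → ℂ :=
  α + Pi.single q 1 + Pi.single r 1 - Pi.single (Fin.last (m + 1)).castSucc 1
    - Pi.single (Fin.last (m + 2)) 1

/-- The function `f` on `T_x` extends holomorphically to all the punctures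
`0, x_1, …, x_m, 1, ∞` of `T_x`. -/
def HolAtPunctures {m : ℕ} (x : Fin m → ℂ) (f : E0 (fiber x)) : Prop :=
  (∀ i, ∃ g : ℂ → ℂ, AnalyticAt ℂ g (pts x i) ∧ ∀ᶠ z in 𝓝[≠] (pts x i), f.1 z = g z) ∧
  ∃ g : ℂ → ℂ, AnalyticAt ℂ g 0 ∧ ∀ᶠ z in cocompact ℂ, f.1 z = g z⁻¹

/-- `ψ` is a form `φ_c = φ - ∇_κ f` with compact support in `T_x`, where `κ = ∑ α_i dt / (t - x_i)`
and the smooth function `f` on `T_x` extends holomorphically to all the punctures (so `f` solves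
`∇_κ f = φ` near every puncture). -/
def IsCompactRep {m : ℕ} (x : Fin m → ℂ) (α : Fin (m + 3) → ℂ) (q r : Fin (m + 3))
    (ψ : Z1c (connForm x α)) : Prop :=
  ∃ f : E0 (fiber x), HolAtPunctures x f ∧
    (ψ.1.1 : E1 (fiber x)) = phi x q r - nabla0 (connForm x α) f

end TwistedCohomology

end

open TwistedCohomology

/-!
# The intersection number of a logarithmic form on a punctured line

Near a puncture, with a coordinate `w` centred at it, a logarithmic form with residues `a i` is
`A(w) dw / w` with `A` holomorphic and `A 0 = a i` (`exists_localCoeff`; at `∞` this uses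
`∑ a i = 0`). Hence `∇_κ f = c` becomes the equation `w f' + A f = B` with a regular singular point,
and everything follows from three facts about it. It has a holomorphic solution unless `A 0` is a
negative integer or a resonant zero (`exists_analyticAt_solution`). If `A 0` is not a positive
integer, each single-valued solution is holomorphic at `w = 0` (`exists_analyticAt_of_solution`).
The value of a holomorphic solution satisfies `A 0 * f 0 = B 0` (`residue_mul_eq`).

Existence of compact representatives is the first fact, with local solutions glued by bump functions
(`exists_local_primitive`).

For the non-vanishing of the classes, suppose that `φ = ∇_κ f`. If `φ` is exact for `-ω̂`, the second
fact shows that `f` is holomorphic at all the punctures; if `φ_c` is exact with compact support, this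
holds by construction. By Liouville's theorem `f` is constant, so `φ = f κ`. The residue of `κ` at the
third distinguished puncture is non-zero while that of `φ` is zero, so `f = 0` and `φ = 0`, which is
absurd (`residue_eq_zero_of_exact`).

By Stokes' theorem the intersection number depends on the classes only (`pairing_congr`), and for the
given representatives it is `-∫ df ∧ φ`. The Cauchy–Pompeiu formula on the sphere
(`integral_dbar_div`) evaluates this as `2πi ∑ Res_{x_i}(φ) f(x_i)`, and the third fact gives
`f(x_i) = Res_{x_i}(φ) / a i`, which yields `2πi (1 / a q + 1 / a r)` (`exists_pairing_eq`).
-/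

noncomputable section

namespace TwistedCohomology

/-! ### The local equation `w f' + A f = B` at a regular singular point -/

theorem eq_of_eventually_nhdsNE {u v : ℂ → ℂ} {c : ℂ} (hu : ContinuousAt u c)
    (hv : ContinuousAt v c) (h : ∀ᶠ w in 𝓝[≠] c, u w = v w) : u c = v c :=
  tendsto_nhds_unique_of_eventuallyEq (hu.tendsto.mono_left nhdsWithin_le_nhds)
    (hv.tendsto.mono_left nhdsWithin_le_nhds) h

/-- The value at the singular point of a holomorphic solution is prescribed by the residue. -/
theorem residue_mul_eq {A B g : ℂ → ℂ} (hA : AnalyticAt ℂ A 0) (hB : AnalyticAt ℂ B 0)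
    (hg : AnalyticAt ℂ g 0) (h : ∀ᶠ w in 𝓝[≠] 0, w * deriv g w + A w * g w = B w) :
    A 0 * g 0 = B 0 := by
  have := eq_of_eventually_nhdsNE (u := fun w => w * deriv g w + A w * g w)
    (((continuousAt_id.mul hg.deriv.continuousAt).add
      (hA.continuousAt.mul hg.continuousAt))) hB.continuousAt h
  simpa using this

/-- Termwise solution of the Euler equation `w F' + a F = C`: the coefficient of `w ^ n` is divided
by `n + a`, which tends to infinity, so the series still converges. -/
theorem exists_analyticAt_euler {C : ℂ → ℂ} (hC : AnalyticAt ℂ C 0) {a : ℂ}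
    (ha : ∀ n : ℕ, a ≠ -((n : ℂ) + 1)) (h0 : a = 0 → C 0 = 0) :
    ∃ F : ℂ → ℂ, AnalyticAt ℂ F 0 ∧ ∀ᶠ w in 𝓝 0, w * deriv F w + a * F w = C w := by
  obtain ⟨p, hp⟩ := hC
  obtain ⟨r, hr⟩ := hp
  obtain ⟨s, hs0, hsr⟩ := ENNReal.lt_iff_exists_nnreal_btwn.mp hr.r_pos
  have hs0 : (0 : ℝ) < s := by exact_mod_cast hs0
  have hsum : Summable fun n => ‖p n‖ * (s : ℝ) ^ n :=
    p.summable_norm_mul_pow (hsr.trans_le hr.r_le)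
  -- a uniform bound for `1 / (n + a)`
  obtain ⟨M, hM⟩ : ∃ M : ℝ, ∀ n : ℕ, ‖((n : ℂ) + a)⁻¹‖ ≤ M := by
    have ht : Tendsto (fun n : ℕ => ((n : ℂ) + a)⁻¹) atTop (𝓝 0) :=
      tendsto_inv₀_cobounded.comp (by
        refine tendsto_norm_atTop_iff_cobounded.mp ?_
        refine tendsto_atTop_mono (fun n => ?_)
          (tendsto_atTop_add_const_right atTop (-‖a‖) tendsto_natCast_atTop_atTop)
        have := norm_sub_norm_le (n : ℂ) (-a)
        simpa using this)
    obtain ⟨M, hM⟩ := (Metric.isBounded_range_of_tendsto _ ht).exists_norm_le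
    exact ⟨M, fun n => hM _ ⟨n, rfl⟩⟩
  have hM0 : 0 ≤ M := (norm_nonneg _).trans (hM 0)
  set G : ℕ → ℂ → ℂ := fun n w => p.coeff n * ((n : ℂ) + a)⁻¹ * w ^ n with hG
  have hle : ∀ n, ∀ w ∈ Metric.ball (0 : ℂ) s, ‖G n w‖ ≤ M * (‖p n‖ * (s : ℝ) ^ n) := by
    intro n w hw
    have hw' : ‖w‖ ≤ s := by simpa using (Metric.mem_ball.mp hw).le
    rw [hG, norm_mul, norm_mul, norm_pow, p.norm_apply_eq_norm_coef]
    calc ‖p.coeff n‖ * ‖((n : ℂ) + a)⁻¹‖ * ‖w‖ ^ n ≤ ‖p.coeff n‖ * M * (s : ℝ) ^ n := by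
          gcongr; exact hM n
      _ = _ := by ring
  have hdiff : ∀ n, DifferentiableOn ℂ (G n) (Metric.ball 0 s) := fun n => by
    rw [hG]; fun_prop
  have hu := hsum.mul_left M
  have hF := Complex.differentiableOn_tsum_of_summable_norm hu hdiff Metric.isOpen_ball hle
  refine ⟨fun w => ∑' n, G n w, hF.analyticAt (Metric.ball_mem_nhds 0 hs0), ?_⟩
  filter_upwards [Metric.ball_mem_nhds (0 : ℂ) hs0] with w hw
  have h1 := Complex.hasSum_deriv_of_summable_norm hu hdiff Metric.isOpen_ball hle hw
  have h2 : HasSum (fun n => G n w) (∑' n, G n w) :=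
    (Summable.of_norm_bounded hu fun n => hle n w hw).hasSum
  have h3 := (h1.mul_left w).add (h2.mul_left a)
  have hw' : w ∈ Metric.eball (0 : ℂ) r := by
    rw [Metric.mem_eball, edist_zero_right]
    refine lt_trans ?_ hsr
    rw [enorm_eq_nnnorm]
    exact_mod_cast (by simpa using hw : ‖w‖ < s)
  have h4 := hr.hasSum hw'
  rw [zero_add] at h4
  have h5 : ∀ n, w * deriv (G n) w + a * G n w = p n fun _ => w := by
    intro n
    have hd : w * deriv (G n) w = n * G n w := by
      simp only [hG]
      rw [deriv_const_mul _ (by fun_prop)]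
      rcases n with _ | n
      · simp
      · simp; ring
    rw [hd, ← add_mul, p.apply_eq_pow_smul_coeff]
    by_cases hn : (n : ℂ) + a = 0
    · -- resonance is only possible for `n = 0`, where the coefficient is `C 0 = 0`
      rcases n with _ | n
      · have ha0 : a = 0 := by simpa using hn
        have : p.coeff 0 = 0 := (hr.coeff_zero _).trans (h0 ha0)
        simp [hG, this, ha0]
      · exact absurd (by push_cast at hn; linear_combination hn) (ha n)
    · simp only [hG, smul_eq_mul]
      field_simp
  simp only [h5] at h3
  exact h3.unique h4

theorem exists_analyticAt_solution {A B : ℂ → ℂ} (hA : AnalyticAt ℂ A 0) (hB : AnalyticAt ℂ B 0)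
    (ha : ∀ n : ℕ, A 0 ≠ -((n : ℂ) + 1)) (h0 : A 0 = 0 → B 0 = 0) :
    ∃ f : ℂ → ℂ, AnalyticAt ℂ f 0 ∧ ∀ᶠ w in 𝓝 0, w * deriv f w + A w * f w = B w := by
  -- `A = A 0 + w A₁`, and `exp H` with `H' = A₁` turns the equation into an Euler equation
  have hA₁ : AnalyticAt ℂ (dslope A 0) 0 := by
    obtain ⟨p, hp⟩ := hA
    exact hp.has_fpower_series_dslope_fslope.analyticAt
  obtain ⟨r, hr, hb⟩ := Metric.eventually_nhds_iff_ball.mp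
    (hA₁.eventually_analyticAt.mono fun z hz => hz.differentiableAt)
  obtain ⟨H, hH⟩ := DifferentiableOn.isExactOn_ball (c := 0) (r := r)
    (fun z hz => (hb z hz).differentiableWithinAt)
  have hHan : AnalyticAt ℂ H 0 :=
    DifferentiableOn.analyticAt (s := Metric.ball 0 r)
      (fun z hz => (hH z hz).differentiableAt.differentiableWithinAt) (Metric.ball_mem_nhds 0 hr)
  obtain ⟨F, hF, hFe⟩ := exists_analyticAt_euler (C := fun w => Complex.exp (H w) * B w)
    (hHan.cexp.mul hB) ha (fun h => by simp [h0 h])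
  refine ⟨fun w => Complex.exp (-H w) * F w, hHan.neg.cexp.mul hF, ?_⟩
  filter_upwards [hFe, hF.eventually_analyticAt, Metric.ball_mem_nhds (0 : ℂ) hr] with w h1 h2 h3
  have hd : HasDerivAt (fun w => Complex.exp (-H w) * F w)
      (Complex.exp (-H w) * (-dslope A 0 w) * F w + Complex.exp (-H w) * deriv F w) w :=
    (hH w h3).neg.cexp.mul h2.differentiableAt.hasDerivAt
  have hs : A w = A 0 + w * dslope A 0 w := by
    have := sub_smul_dslope A 0 w
    simp only [sub_zero, smul_eq_mul] at this
    rw [this]; ring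
  have he : Complex.exp (-H w) * Complex.exp (H w) = 1 := by
    rw [← Complex.exp_add]; simp
  rw [hd.deriv, hs]
  linear_combination Complex.exp (-H w) * h1 + B w * he

/-- Solutions on a punctured disc grow at most like a power of `w`, by Grönwall's inequality along
the rays towards the singular point. -/
theorem exists_pow_bound_of_solution {A B f : ℂ → ℂ} (hA : AnalyticAt ℂ A 0)
    (hB : AnalyticAt ℂ B 0)
    (hf : ∀ᶠ w in 𝓝[≠] 0, DifferentiableAt ℂ f w ∧ w * deriv f w + A w * f w = B w) :
    ∃ (N : ℕ) (C : ℝ), ∀ᶠ w in 𝓝[≠] 0, ‖w ^ N * f w‖ ≤ C := by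
  obtain ⟨N, hAN, hBN⟩ : ∃ N : ℕ, (∀ᶠ w in 𝓝 0, ‖A w‖ ≤ N + 1) ∧ ∀ᶠ w in 𝓝 0, ‖B w‖ ≤ N + 1 := by
    obtain ⟨N, hN⟩ := exists_nat_gt (max ‖A 0‖ ‖B 0‖)
    refine ⟨N, ?_, ?_⟩
    · filter_upwards [hA.continuousAt.norm.eventually_lt_const
        ((le_max_left _ _).trans_lt hN)] with w hw using by linarith
    · filter_upwards [hB.continuousAt.norm.eventually_lt_const
        ((le_max_right _ _).trans_lt hN)] with w hw using by linarith
  obtain ⟨R', hR', hball⟩ := Metric.eventually_nhds_iff_ball.mp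
    ((eventually_nhdsWithin_iff.mp hf).and (hAN.and hBN))
  set R := R' / 2 with hRdef
  have hR : 0 < R := by positivity
  have key : ∀ w : ℂ, w ≠ 0 → ‖w‖ ≤ R → DifferentiableAt ℂ f w ∧
      ‖w * deriv f w‖ ≤ ((N : ℝ) + 1) * ‖f w‖ + (N + 1) := by
    intro w hw hwR
    have hmem : w ∈ Metric.ball (0 : ℂ) R' := by
      rw [mem_ball_zero_iff]; linarith
    obtain ⟨h1, h2, h3⟩ := hball w hmem
    obtain ⟨h4, h5⟩ := h1 hw
    refine ⟨h4, ?_⟩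
    rw [eq_sub_of_add_eq h5, add_comm]
    refine (norm_sub_le _ _).trans (add_le_add h3 ?_)
    rw [norm_mul]
    gcongr
  obtain ⟨δ, hδ⟩ : ∃ δ : ℝ, ∀ v ∈ Metric.sphere (0 : ℂ) R, ‖f v‖ ≤ δ := by
    refine (isCompact_sphere (0 : ℂ) R).exists_bound_of_continuousOn fun v hv => ?_
    have hv' : ‖v‖ = R := by simpa using hv
    exact (key v (norm_pos_iff.mp (hv' ▸ hR)) hv'.le).1.continuousAt.continuousWithinAt
  refine ⟨N + 1, (δ + 1) * R ^ (N + 1), ?_⟩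
  filter_upwards [self_mem_nhdsWithin,
    nhdsWithin_le_nhds (Metric.ball_mem_nhds (0 : ℂ) hR)] with w hw0 hwR
  have hw0 : w ≠ 0 := hw0
  have hwR : ‖w‖ < R := by simpa using hwR
  have hwn : 0 < ‖w‖ := norm_pos_iff.mpr hw0
  -- the ray `γ s = v e ^ (-s)` runs from the circle of radius `R` to `w = γ S`
  set v : ℂ := ((R / ‖w‖ : ℝ) : ℂ) * w with hv
  have hvn : ‖v‖ = R := by
    rw [hv, norm_mul, Complex.norm_real, Real.norm_of_nonneg (by positivity)]
    field_simp
  have hv0 : v ≠ 0 := norm_pos_iff.mp (hvn ▸ hR)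
  set γ : ℝ → ℂ := fun s => v * Complex.exp (-(s : ℂ)) with hγ
  have hγn : ∀ s, ‖γ s‖ = R * Real.exp (-s) := fun s => by
    rw [hγ, norm_mul, hvn, Complex.norm_exp]; simp
  have hγ0 : ∀ s, γ s ≠ 0 := fun s => mul_ne_zero hv0 (Complex.exp_ne_zero _)
  have hγR : ∀ s, 0 ≤ s → ‖γ s‖ ≤ R := fun s hs => by
    rw [hγn]
    exact mul_le_of_le_one_right hR.le (Real.exp_le_one_iff.mpr (by linarith))
  have hγd : ∀ s, HasDerivAt γ (-γ s) s := fun s => by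
    have : HasDerivAt (fun s : ℝ => Complex.exp (-(s : ℂ))) (Complex.exp (-(s : ℂ)) * -1) s :=
      ((Complex.ofRealCLM.hasDerivAt (x := s)).neg).cexp
    have h := this.const_mul v
    rwa [show v * (Complex.exp (-(s : ℂ)) * -1) = -γ s by simp [hγ]] at h
  have hfd : ∀ s, 0 ≤ s → HasDerivAt (fun s => f (γ s)) (deriv f (γ s) * -γ s) s := fun s hs => by
    have := (key (γ s) (hγ0 s) (hγR s hs)).1.hasDerivAt
    exact this.comp s (hγd s)
  set S := Real.log (R / ‖w‖) with hS
  have hS0 : 0 ≤ S := Real.log_nonneg ((one_le_div hwn).mpr hwR.le)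
  have hexpS : Real.exp S = R / ‖w‖ := Real.exp_log (by positivity)
  have hγS : γ S = w := by
    simp only [hγ, hv]
    rw [Complex.exp_neg, ← Complex.ofReal_exp, hexpS]
    have : ((R / ‖w‖ : ℝ) : ℂ) ≠ 0 := Complex.ofReal_ne_zero.mpr (by positivity)
    field_simp
  have hgr := norm_le_gronwallBound_of_norm_deriv_right_le (f := fun s => f (γ s))
    (f' := fun s => deriv f (γ s) * -γ s) (δ := δ) (K := (N : ℝ) + 1) (ε := (N : ℝ) + 1)
    (a := 0) (b := S)
    (fun s hs => (hfd s hs.1).continuousAt.continuousWithinAt)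
    (fun s hs => (hfd s hs.1).hasDerivWithinAt)
    (hδ _ (by simp [hγ, hvn]))
    (fun s hs => by
      have := (key (γ s) (hγ0 s) (hγR s hs.1)).2
      rwa [mul_neg, norm_neg, mul_comm (deriv f _)])
    S ⟨hS0, le_rfl⟩
  have hN : (N : ℝ) + 1 ≠ 0 := by positivity
  rw [hγS, gronwallBound_of_K_ne_0 hN, div_self hN, sub_zero] at hgr
  simp only [one_mul] at hgr
  have hpow : Real.exp (((N : ℝ) + 1) * S) = (R / ‖w‖) ^ (N + 1) := by
    rw [← hexpS, ← Real.exp_nat_mul]; push_cast; rfl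
  rw [hpow] at hgr
  rw [norm_mul, norm_pow]
  calc ‖w‖ ^ (N + 1) * ‖f w‖
      ≤ ‖w‖ ^ (N + 1) * ((δ + 1) * (R / ‖w‖) ^ (N + 1)) := by gcongr; linarith
    _ = (δ + 1) * R ^ (N + 1) := by rw [div_pow]; field_simp

/-- If no positive integer is a possible pole order, that is, if `A 0` is not a positive integer,
single-valued solutions on a punctured disc extend holomorphically. -/
theorem exists_analyticAt_of_solution {A B f : ℂ → ℂ} (hA : AnalyticAt ℂ A 0)
    (hB : AnalyticAt ℂ B 0) (ha : ∀ n : ℕ, A 0 ≠ (n : ℂ) + 1)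
    (hf : ∀ᶠ w in 𝓝[≠] 0, DifferentiableAt ℂ f w ∧ w * deriv f w + A w * f w = B w) :
    ∃ g : ℂ → ℂ, AnalyticAt ℂ g 0 ∧ ∀ᶠ w in 𝓝[≠] 0, f w = g w := by
  obtain ⟨N, C, hC⟩ := exists_pow_bound_of_solution hA hB hf
  have hmer : MeromorphicAt f 0 := by
    refine ⟨N + 1, Complex.analyticAt_of_differentiable_on_punctured_nhds_of_continuousAt ?_ ?_⟩
    · filter_upwards [hf] with w hw
      have := hw.1
      fun_prop
    · rw [continuousAt_iff_punctured_nhds]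
      have h1 : Tendsto (fun w : ℂ => ‖w‖ * C) (𝓝[≠] 0) (𝓝 0) := by
        have : ContinuousAt (fun w : ℂ => ‖w‖ * C) 0 := by fun_prop
        simpa using this.tendsto.mono_left nhdsWithin_le_nhds
      simp only [sub_zero, ne_eq, Nat.add_eq_zero_iff, one_ne_zero, and_false, not_false_eq_true,
        zero_pow, zero_smul, sub_self]
      refine squeeze_zero_norm' ?_ h1
      filter_upwards [hC] with w hw
      rw [smul_eq_mul, pow_succ', mul_assoc, norm_mul]
      gcongr
  by_cases htop : meromorphicOrderAt f 0 = ⊤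
  · exact ⟨fun _ => 0, analyticAt_const, meromorphicOrderAt_eq_top_iff.mp htop⟩
  obtain ⟨n, hn⟩ := WithTop.ne_top_iff_exists.mp htop
  obtain ⟨g, hg, hg0, hfg⟩ := (meromorphicOrderAt_eq_int_iff hmer).mp hn.symm
  simp only [sub_zero, smul_eq_mul] at hfg
  rcases n with n | k
  · exact ⟨fun w => w ^ n * g w, by fun_prop, by simpa using hfg⟩
  -- a pole of order `k + 1` contradicts the equation for the leading coefficient
  exfalso
  have hfg' := eventually_eventually_nhdsWithin.mpr hfg
  have hlim : ∀ᶠ w in 𝓝[≠] (0 : ℂ),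
      (-((k : ℂ) + 1) + A w) * g w + w * deriv g w = w ^ (k + 1) * B w := by
    filter_upwards [hf, hfg', self_mem_nhdsWithin,
      nhdsWithin_le_nhds hg.eventually_analyticAt, hfg] with w h1 h2 h3 h4 h5
    have hw : w ≠ 0 := h3
    rw [isOpen_compl_singleton.nhdsWithin_eq hw] at h2
    have hd : HasDerivAt (fun w : ℂ => w ^ (Int.negSucc k) * g w)
        ((Int.negSucc k : ℤ) * w ^ (Int.negSucc k - 1) * g w
          + w ^ (Int.negSucc k) * deriv g w) w :=
      (hasDerivAt_zpow _ _ (Or.inl hw)).mul h4.differentiableAt.hasDerivAt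
    have h6 := h1.2
    rw [EventuallyEq.deriv_eq h2, hd.deriv, h5, zpow_sub_one₀ hw, zpow_negSucc] at h6
    rw [← h6]
    push_cast
    field_simp
    ring
  have := eq_of_eventually_nhdsNE
    (u := fun w => (-((k : ℂ) + 1) + A w) * g w + w * deriv g w)
    (v := fun w => w ^ (k + 1) * B w)
    (((continuousAt_const.add hA.continuousAt).mul hg.continuousAt).add
      (continuousAt_id.mul hg.deriv.continuousAt))
    ((continuousAt_id.pow _).mul hB.continuousAt) hlim
  simp only [zero_mul, add_zero, ne_eq, Nat.add_eq_zero_iff, one_ne_zero, and_false,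
    not_false_eq_true, zero_pow, mul_eq_zero, hg0, or_false] at this
  exact ha k (by linear_combination this)

/-! ### The Cauchy–Pompeiu formula -/

/-- The Cauchy–Riemann operator, normalized as `∂F/∂x + i ∂F/∂y = 2 ∂F/∂z̄`. -/
def dbar (F : ℂ → ℂ) (z : ℂ) : ℂ := fderiv ℝ F z 1 + Complex.I * fderiv ℝ F z Complex.I

theorem continuous_dbar {F : ℂ → ℂ} (hF : ContDiff ℝ 1 F) : Continuous (dbar F) := by
  have := hF.continuous_fderiv (by simp)
  unfold dbar
  fun_prop

theorem _root_.HasDerivAt.dbar_eq_zero {F : ℂ → ℂ} {F' z : ℂ} (h : HasDerivAt F F' z) :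
    dbar F z = 0 := by
  have := (h.hasFDerivAt.restrictScalars ℝ).fderiv
  rw [dbar, this]
  simp only [ContinuousLinearMap.coe_restrictScalars', ContinuousLinearMap.toSpanSingleton_apply,
    smul_eq_mul, one_mul]
  linear_combination F' * Complex.I_mul_I

theorem _root_.Filter.EventuallyEq.dbar_eq {F G : ℂ → ℂ} {z : ℂ} (h : F =ᶠ[𝓝 z] G) :
    dbar F z = dbar G z := by
  rw [dbar, dbar, h.fderiv_eq]

/-- In polar coordinates `w + ρ e ^ (iθ)`, `e ^ (-iθ)` times the Cauchy–Riemann operator is the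
radial derivative plus `i` times the tangential derivative. -/
theorem dbar_mul_exp_neg (F : ℂ → ℂ) (z : ℂ) (θ : ℝ) :
    dbar F z * (Complex.exp (θ * Complex.I))⁻¹ = fderiv ℝ F z (Complex.exp (θ * Complex.I)) +
      Complex.I * fderiv ℝ F z (Complex.I * Complex.exp (θ * Complex.I)) := by
  have h1 : Complex.exp (θ * Complex.I)
      = (Real.cos θ) • (1 : ℂ) + (Real.sin θ) • Complex.I := by
    rw [Complex.exp_mul_I]; simp
  have h2 : Complex.I * Complex.exp (θ * Complex.I)
      = (-Real.sin θ) • (1 : ℂ) + (Real.cos θ) • Complex.I := by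
    rw [h1]; simp only [Complex.real_smul]; push_cast
    linear_combination Complex.sin θ * Complex.I_mul_I
  have h3 : (Complex.exp (θ * Complex.I))⁻¹ = Real.cos θ - Real.sin θ * Complex.I := by
    rw [← Complex.exp_neg, ← neg_mul, ← Complex.ofReal_neg, Complex.exp_mul_I]
    simp [sub_eq_add_neg]
  rw [h2, h3, h1, map_add, map_add, map_smul, map_smul, map_smul, map_smul, dbar]
  simp only [Complex.real_smul]; push_cast
  linear_combination -Complex.sin θ * fderiv ℝ F z Complex.I * Complex.I_mul_I

/-- The area integral in polar coordinates around `w`: the tangential derivative integrates to zero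
over each circle, and the radial one integrates to `F` on the outer circle minus `F w`. -/
theorem integral_dbar_div_eq_circle {F : ℂ → ℂ} (hF : ContDiff ℝ 1 F) {w : ℂ} {R : ℝ} (hR : 0 ≤ R)
    (h0 : ∀ z, R < ‖z - w‖ → dbar F z = 0) :
    ∫ z, dbar F z * (z - w)⁻¹ =
      ∫ θ in (-Real.pi)..Real.pi, (F (circleMap w R θ) - F w) := by
  have hpi : -Real.pi ≤ Real.pi := by linarith [Real.pi_pos]
  have hFd : Differentiable ℝ F := hF.differentiable (by simp)
  have hcd := hF.continuous_fderiv (by simp)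
  set A : ℝ → ℝ → ℂ := fun ρ θ => fderiv ℝ F (circleMap w ρ θ) (Complex.exp (θ * Complex.I))
    with hA
  set B : ℝ → ℝ → ℂ := fun ρ θ =>
    fderiv ℝ F (circleMap w ρ θ) (Complex.I * Complex.exp (θ * Complex.I)) with hB
  have hcm : Continuous fun p : ℝ × ℝ => circleMap w p.1 p.2 := by
    unfold circleMap; fun_prop
  have hAc : Continuous fun p : ℝ × ℝ => A p.1 p.2 := by
    have := hcd.comp hcm
    simp only [hA]
    exact this.clm_apply (by fun_prop)
  have hBc : Continuous fun p : ℝ × ℝ => B p.1 p.2 := by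
    have := hcd.comp hcm
    simp only [hB]
    exact this.clm_apply (by fun_prop)
  have hkc : Continuous fun p : ℝ × ℝ => A p.1 p.2 + Complex.I * B p.1 p.2 :=
    hAc.add (continuous_const.mul hBc)
  have hpol : ∀ p : ℝ × ℝ, Complex.polarCoord.symm p + w = circleMap w p.1 p.2 := fun p => by
    rw [Complex.polarCoord_symm_apply, circleMap, Complex.exp_mul_I, add_comm]; push_cast; rfl
  have hBint : ∀ ρ : ℝ, 0 < ρ → ∫ θ in (-Real.pi)..Real.pi, B ρ θ = 0 := fun ρ hρ => by
    have hd : ∀ θ ∈ Set.uIcc (-Real.pi) Real.pi,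
        HasDerivAt (fun θ => F (circleMap w ρ θ)) ((ρ : ℂ) * B ρ θ) θ := fun θ _ => by
      have := (hFd (circleMap w ρ θ)).hasFDerivAt.comp_hasDerivAt θ (hasDerivAt_circleMap w ρ θ)
      refine this.congr_deriv ?_
      have h2 : circleMap 0 ρ θ * Complex.I
          = ρ • (Complex.I * Complex.exp (θ * Complex.I)) := by
        rw [circleMap, Complex.real_smul]; ring
      rw [h2, map_smul, Complex.real_smul]
    have hc : Continuous fun θ => (ρ : ℂ) * B ρ θ :=
      continuous_const.mul (hBc.comp (Continuous.prodMk_right ρ))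
    have h3 := intervalIntegral.integral_eq_sub_of_hasDerivAt hd (hc.intervalIntegrable _ _)
    have h4 : circleMap w ρ Real.pi = circleMap w ρ (-Real.pi) := by
      have := periodic_circleMap w ρ (-Real.pi)
      rw [← this]; congr 1; ring
    rw [h4, sub_self, intervalIntegral.integral_const_mul] at h3
    exact (mul_eq_zero.mp h3).resolve_left (Complex.ofReal_ne_zero.mpr hρ.ne')
  have hAint : ∀ θ : ℝ, ∫ ρ in (0)..R, A ρ θ = F (circleMap w R θ) - F w := fun θ => by
    have hd : ∀ ρ ∈ Set.uIcc 0 R, HasDerivAt (fun ρ : ℝ => F (circleMap w ρ θ)) (A ρ θ) ρ :=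
      fun ρ _ => by
        have h1 : HasDerivAt (fun ρ : ℝ => circleMap w ρ θ) (Complex.exp (θ * Complex.I)) ρ := by
          have := ((Complex.ofRealCLM.hasDerivAt (x := ρ)).mul_const
            (Complex.exp (θ * Complex.I))).const_add w
          simpa [circleMap] using this
        exact (hFd (circleMap w ρ θ)).hasFDerivAt.comp_hasDerivAt ρ h1
    rw [intervalIntegral.integral_eq_sub_of_hasDerivAt hd
      ((hAc.comp (Continuous.prodMk_left θ)).intervalIntegrable _ _)]
    simp [circleMap]
  calc ∫ z, dbar F z * (z - w)⁻¹
      = ∫ z, dbar F (z + w) * (z + w - w)⁻¹ :=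
        (integral_add_right_eq_self (fun z => dbar F z * (z - w)⁻¹) w).symm
    _ = ∫ p in polarCoord.target, p.1 • (dbar F (Complex.polarCoord.symm p + w) *
          (Complex.polarCoord.symm p + w - w)⁻¹) :=
        (Complex.integral_comp_polarCoord_symm
          fun z => dbar F (z + w) * (z + w - w)⁻¹).symm
    _ = ∫ p in Set.Ioi (0 : ℝ) ×ˢ Set.Ioo (-Real.pi) Real.pi,
          (A p.1 p.2 + Complex.I * B p.1 p.2) := by
        rw [polarCoord_target]
        refine setIntegral_congr_fun (measurableSet_Ioi.prod measurableSet_Ioo) fun p hp => ?_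
        have hp1 : (p.1 : ℂ) ≠ 0 := Complex.ofReal_ne_zero.mpr (ne_of_gt hp.1)
        simp only [hpol, hA, hB, ← dbar_mul_exp_neg]
        rw [Complex.real_smul, circleMap, add_sub_cancel_left, mul_inv]
        field_simp
    _ = ∫ p in Set.Ioc (0 : ℝ) R ×ˢ Set.Ioo (-Real.pi) Real.pi,
          (A p.1 p.2 + Complex.I * B p.1 p.2) := by
        refine (setIntegral_eq_of_subset_of_forall_sdiff_eq_zero
          (measurableSet_Ioi.prod measurableSet_Ioo)
          (Set.prod_mono Set.Ioc_subset_Ioi_self subset_rfl) fun p hp => ?_)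
        have hp1 : R < p.1 := by
          by_contra h
          exact hp.2 ⟨⟨hp.1.1, not_lt.mp h⟩, hp.1.2⟩
        simp only [hA, hB, ← dbar_mul_exp_neg]
        rw [h0, zero_mul]
        simp only [circleMap, add_sub_cancel_left, norm_mul, Complex.norm_real,
          Complex.norm_exp_ofReal_mul_I, mul_one]
        exact hp1.trans_le (le_abs_self _)
    _ = ∫ ρ in Set.Ioc (0 : ℝ) R, ∫ θ in Set.Ioo (-Real.pi) Real.pi,
          (A ρ θ + Complex.I * B ρ θ) := by
        rw [Measure.volume_eq_prod]
        refine setIntegral_prod _ ?_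
        refine (hkc.continuousOn.integrableOn_compact
          (isCompact_Icc.prod isCompact_Icc)).mono_set
          (Set.prod_mono Set.Ioc_subset_Icc_self Set.Ioo_subset_Icc_self)
    _ = ∫ ρ in (0)..R, ∫ θ in (-Real.pi)..Real.pi, A ρ θ := by
        rw [intervalIntegral.integral_of_le hR]
        refine setIntegral_congr_fun measurableSet_Ioc fun ρ hρ => ?_
        simp only [← integral_Ioc_eq_integral_Ioo, ← intervalIntegral.integral_of_le hpi]
        have hA' : Continuous fun θ => A ρ θ := hAc.comp (Continuous.prodMk_right ρ)
        have hB' : Continuous fun θ => Complex.I * B ρ θ :=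
          continuous_const.mul (hBc.comp (Continuous.prodMk_right ρ))
        rw [intervalIntegral.integral_add (hA'.intervalIntegrable _ _)
          (hB'.intervalIntegrable _ _), intervalIntegral.integral_const_mul, hBint ρ hρ.1, mul_zero, add_zero]
    _ = ∫ θ in (-Real.pi)..Real.pi, ∫ ρ in (0)..R, A ρ θ := by
        refine intervalIntegral_intervalIntegral_swap ?_
        exact (hAc.continuousOn.integrableOn_compact
          (isCompact_uIcc.prod isCompact_uIcc)).mono_set
          (Set.prod_mono Set.uIoc_subset_uIcc Set.uIoc_subset_uIcc)
    _ = ∫ θ in (-Real.pi)..Real.pi, (F (circleMap w R θ) - F w) := by simp only [hAint]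

/-- The Cauchy–Pompeiu formula on the Riemann sphere: `F` is holomorphic near `∞` with value `L`
there. -/
theorem integral_dbar_div {F : ℂ → ℂ} (hF : ContDiff ℝ 1 F) {L : ℂ}
    (hL : Tendsto F (cocompact ℂ) (𝓝 L)) (h0 : ∀ᶠ z in cocompact ℂ, dbar F z = 0) (w : ℂ) :
    ∫ z, dbar F z * (z - w)⁻¹ = 2 * Real.pi * (L - F w) := by
  have hpi := Real.pi_pos
  refine eq_of_forall_dist_le fun ε hε => ?_
  have hev := h0.and (hL.eventually (Metric.closedBall_mem_nhds L
    (show 0 < ε / (2 * Real.pi) by positivity)))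
  rw [← Metric.cobounded_eq_cocompact, ← Metric.comap_dist_right_atTop w, eventually_comap] at hev
  obtain ⟨R, hR⟩ := eventually_atTop.mp hev
  have hR' : ∀ z, max R 0 ≤ ‖z - w‖ → dbar F z = 0 ∧ dist (F z) L ≤ ε / (2 * Real.pi) :=
    fun z hz => hR (dist z w) (by rw [dist_eq_norm]; exact (le_max_left _ _).trans hz) z rfl
  rw [integral_dbar_div_eq_circle hF (le_max_right R 0) fun z hz => (hR' z hz.le).1]
  have hcont : Continuous fun θ => F (circleMap w (max R 0) θ) - F w :=
    (hF.continuous.comp (continuous_circleMap _ _)).sub continuous_const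
  have h1 : (2 * Real.pi * (L - F w) : ℂ) = ∫ θ in (-Real.pi)..Real.pi, (L - F w) := by
    rw [intervalIntegral.integral_const, Complex.real_smul]; push_cast; ring
  rw [dist_eq_norm, h1, ← intervalIntegral.integral_sub
    (hcont.intervalIntegrable _ _) (by simp)]
  refine (intervalIntegral.norm_integral_le_of_norm_le_const (C := ε / (2 * Real.pi))
    fun θ _ => ?_).trans ?_
  · rw [sub_sub_sub_cancel_right, ← dist_eq_norm]
    exact (hR' _ (by simp [circleMap, abs_of_nonneg])).2
  · rw [sub_neg_eq_add, ← two_mul, abs_of_pos (by positivity)]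
    field_simp
    exact le_rfl

/-- Stokes' theorem for a compactly supported function on the plane. -/
theorem integral_fderiv_apply_eq_zero {F : ℂ → ℂ} (hF : ContDiff ℝ 1 F) (hc : HasCompactSupport F)
    (v : ℂ) : ∫ z, fderiv ℝ F z v = 0 := by
  have hFd : Differentiable ℝ F := hF.differentiable (by simp)
  have hi : Integrable fun z => fderiv ℝ F z v :=
    ((hF.continuous_fderiv (by simp)).clm_apply continuous_const).integrable_of_hasCompactSupport
      (hc.fderiv_apply ℝ v)
  have hi0 : Integrable F := hF.continuous.integrable_of_hasCompactSupport hc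
  have := integral_mul_fderiv_eq_neg_fderiv_mul_of_integrable (μ := volume)
    (f := fun _ : ℂ => (1 : ℂ)) (g := F) (v := v) (by simp) (by simpa using hi) (by simpa using hi0)
    (fun _ _ => by simp) (fun x _ => hFd x)
  simpa using this

/-! ### Logarithmic forms and coordinates at the punctures -/

section

variable {m : ℕ} {x : Fin m → ℂ}

/-- The coefficient `∑ aᵢ / (z - xᵢ)` of the logarithmic form `connForm x a`. -/
def logCoeff (x : Fin m → ℂ) (a : Fin (m + 3) → ℂ) (z : ℂ) : ℂ :=
  ∑ i : Fin (m + 2), a i.castSucc * (z - pts x i)⁻¹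

theorem mem_fiber {z : ℂ} : z ∈ fiber x ↔ ∀ i, z ≠ pts x i :=
  ⟨fun h i hi => h ⟨i, hi.symm⟩, fun h ⟨i, hi⟩ => h i hi.symm⟩

theorem pts_notMem_fiber (i : Fin (m + 2)) : pts x i ∉ fiber x := fun h => h ⟨i, rfl⟩

theorem connForm_apply (a : Fin (m + 3) → ℂ) {z : ℂ} (hz : z ∈ fiber x) :
    (connForm x a).1 z = (logCoeff x a z, logCoeff x a z * Complex.I) := by
  have hsum : ∀ s : Finset (Fin (m + 2)),
      (∑ i ∈ s, a i.castSucc • dlog x i.castSucc : E1 (fiber x)).1 z =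
        ∑ i ∈ s, (a i.castSucc * (z - pts x i)⁻¹, a i.castSucc * (z - pts x i)⁻¹ * Complex.I) := by
    intro s
    induction s using Finset.induction_on with
    | empty => simp
    | insert i s hi ih =>
      rw [Finset.sum_insert hi, Finset.sum_insert hi, Smooth.add_val, Pi.add_apply, ih]
      congr 1
      rw [Smooth.smul_val, Pi.smul_apply]
      simp [dlog, holForm, hz, mul_assoc]
  rw [connForm, hsum, logCoeff, Finset.sum_mul]
  ext <;> simp [Prod.fst_sum, Prod.snd_sum]

theorem connForm_neg (a : Fin (m + 3) → ℂ) : connForm x (-a) = -connForm x a := by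
  simp [connForm]

theorem dlog_eq_connForm (i : Fin (m + 3)) : dlog x i = connForm x (Pi.single i 1) := by
  rw [connForm]
  induction i using Fin.lastCases with
  | last => simp [dlog, (Fin.castSucc_ne_last _)]
  | cast i =>
    rw [Finset.sum_eq_single i]
    · simp
    · intro j _ hj
      simp [hj]
    · simp

theorem phi_eq_connForm (q r : Fin (m + 3)) :
    phi x q r = connForm x (Pi.single q 1 - Pi.single r 1) := by
  rw [phi, dlog_eq_connForm, dlog_eq_connForm, connForm, connForm, connForm,
    ← Finset.sum_sub_distrib]
  exact Finset.sum_congr rfl fun i _ => (sub_smul _ _ _).symm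

/-- At a point of `T`, `∇_κ f = c` for logarithmic forms says that `f` is holomorphic with
`f' = c - κ f`. -/
theorem nabla0_apply_eq_iff (a c : Fin (m + 3) → ℂ) (f : E0 (fiber x)) {z : ℂ}
    (hz : z ∈ fiber x) :
    (nabla0 (connForm x a) f).1 z = (connForm x c).1 z ↔
      HasDerivAt f.1 (logCoeff x c z - logCoeff x a z * f.1 z) z := by
  have h0 : (nabla0 (connForm x a) f).1 z = d0 f.1 z + f.1 z • (connForm x a).1 z := by
    simp [nabla0, nabla0Fun, hz]
  rw [h0, connForm_apply a hz, connForm_apply c hz, d0, Prod.ext_iff]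
  simp only [Prod.fst_add, Prod.snd_add, Prod.smul_mk, smul_eq_mul]
  set D := logCoeff x c z - logCoeff x a z * f.1 z with hD
  constructor
  · rintro ⟨h1, h2⟩
    have hf := (f.differentiableAt hz).hasFDerivAt
    have : fderiv ℝ f.1 z = (ContinuousLinearMap.toSpanSingleton ℂ D).restrictScalars ℝ := by
      refine ContinuousLinearMap.ext fun w => ?_
      have hw : w = w.re • (1 : ℂ) + w.im • Complex.I := by
        simp [Complex.re_add_im]
      rw [hw, map_add, map_add, map_smul, map_smul, map_smul, map_smul]
      have e1 : fderiv ℝ f.1 z 1 = D := by rw [hD]; linear_combination h1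
      have e2 : fderiv ℝ f.1 z Complex.I = Complex.I * D := by
        rw [hD]; linear_combination h2
      rw [e1, e2]
      simp
    rw [this] at hf
    exact hasFDerivAt_of_restrictScalars ℝ hf rfl
  · intro h
    have hf := (h.hasFDerivAt.restrictScalars ℝ).fderiv
    rw [hf]
    simp only [ContinuousLinearMap.coe_restrictScalars',
      ContinuousLinearMap.toSpanSingleton_apply, smul_eq_mul, hD]
    constructor <;> ring

/-- A coordinate at the puncture `xᵢ` of the Riemann sphere: `w ↦ xᵢ + w` for a finite puncture,
and `w ↦ 1 / w` for `xᵢ = ∞`. -/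
def chart (x : Fin m → ℂ) (i : Fin (m + 3)) : ℂ → ℂ :=
  Fin.lastCases (motive := fun _ => ℂ → ℂ) (fun w => w⁻¹) (fun i w => pts x i + w) i

@[simp]
theorem chart_last : chart x (Fin.last (m + 2)) = fun w => w⁻¹ := by
  simp [chart]

@[simp]
theorem chart_castSucc (i : Fin (m + 2)) : chart x i.castSucc = fun w => pts x i + w := by
  simp [chart]

theorem eventually_chart_last {P : ℂ → Prop} :
    (∀ᶠ w in 𝓝[≠] 0, P (chart x (Fin.last (m + 2)) w)) ↔ ∀ᶠ z in cocompact ℂ, P z := by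
  rw [chart_last, ← Metric.cobounded_eq_cocompact]
  refine ⟨fun h => ?_, fun h => tendsto_inv₀_nhdsNE_zero.eventually h⟩
  simpa using tendsto_inv₀_cobounded'.eventually h

theorem eventually_chart_castSucc {P : ℂ → Prop} (i : Fin (m + 2)) :
    (∀ᶠ w in 𝓝[≠] 0, P (chart x i.castSucc w)) ↔ ∀ᶠ z in 𝓝[≠] (pts x i), P z := by
  rw [chart_castSucc, ← eventually_map (P := P) (m := fun w => pts x i + w)]
  rw [show map (fun w => pts x i + w) (𝓝[≠] 0) = 𝓝[≠] (pts x i) by simp]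

theorem eventually_chart_mem (i : Fin (m + 3)) : ∀ᶠ w in 𝓝[≠] 0, chart x i w ∈ fiber x := by
  have h : ((fiber x : Opens ℂ) : Set ℂ) ∈ (cofinite : Filter ℂ) :=
    (Set.finite_range (pts x)).compl_mem_cofinite
  induction i using Fin.lastCases with
  | last => exact eventually_chart_last.mpr (cocompact_le_cofinite h)
  | cast i => exact (eventually_chart_castSucc i).mpr (nhdsNE_le_cofinite _ h)

theorem holAtPunctures_iff {f : E0 (fiber x)} : HolAtPunctures x f ↔
    ∀ i, ∃ g : ℂ → ℂ, AnalyticAt ℂ g 0 ∧ ∀ᶠ w in 𝓝[≠] 0, f.1 (chart x i w) = g w := by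
  rw [Fin.forall_fin_succ', HolAtPunctures]
  refine and_congr (forall_congr' fun i => ⟨?_, ?_⟩) ⟨?_, ?_⟩
  · rintro ⟨g, hg, h⟩
    refine ⟨fun w => g (pts x i + w), ?_, ?_⟩
    · exact AnalyticAt.fun_comp (by simpa using hg) (by fun_prop)
    · exact (eventually_chart_castSucc (P := fun z => f.1 z = g z) i).mpr h |>.mono
        fun w hw => by simpa using hw
  · rintro ⟨g, hg, h⟩
    refine ⟨fun z => g (z - pts x i), ?_, ?_⟩
    · exact AnalyticAt.fun_comp (by simpa using hg) (by fun_prop)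
    · refine (eventually_chart_castSucc (P := fun z => f.1 z = g (z - pts x i)) i).mp ?_
      exact h.mono fun w hw => by simpa using hw
  · rintro ⟨g, hg, h⟩
    refine ⟨g, hg, ?_⟩
    exact (eventually_chart_last (x := x) (P := fun z => f.1 z = g z⁻¹)).mpr h |>.mono
      fun w hw => by simpa using hw
  · rintro ⟨g, hg, h⟩
    refine ⟨g, hg, (eventually_chart_last (x := x) (P := fun z => f.1 z = g z⁻¹)).mp ?_⟩
    exact h.mono fun w hw => by simpa using hw

/-- In the coordinate `w` at a puncture, a logarithmic form is `A(w) dw / w` with `A` holomorphic,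
and `A 0` is the residue. At `∞` this uses that the residues add up to zero. -/
theorem exists_localCoeff (hx : Function.Injective (pts x)) {a : Fin (m + 3) → ℂ}
    (ha : ∑ i, a i = 0) (i : Fin (m + 3)) :
    ∃ A : ℂ → ℂ, AnalyticAt ℂ A 0 ∧ A 0 = a i ∧ ∀ w ≠ 0, DifferentiableAt ℂ (chart x i) w ∧
      w * deriv (chart x i) w * logCoeff x a (chart x i w) = A w := by
  induction i using Fin.lastCases with
  | last =>
    refine ⟨fun w => -∑ j : Fin (m + 2), a j.castSucc * (1 - pts x j * w)⁻¹, ?_, ?_, ?_⟩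
    · refine AnalyticAt.neg (Finset.analyticAt_fun_sum _ fun j _ => analyticAt_const.mul ?_)
      exact AnalyticAt.fun_inv (by fun_prop) (by simp)
    · rw [Fin.sum_univ_castSucc] at ha
      simp only [mul_zero, sub_zero, inv_one, mul_one]
      linear_combination -ha
    · intro w hw
      rw [chart_last]
      refine ⟨by fun_prop (disch := assumption), ?_⟩
      rw [deriv_inv, logCoeff, Finset.mul_sum]
      simp only [← Finset.sum_neg_distrib]
      refine Finset.sum_congr rfl fun j _ => ?_
      rw [show w⁻¹ - pts x j = (1 - pts x j * w) * w⁻¹ by field_simp, mul_inv, inv_inv]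
      field_simp
  | cast i =>
    refine ⟨fun w => a i.castSucc +
      ∑ j ∈ Finset.univ.erase i, w * (a j.castSucc * (pts x i + w - pts x j)⁻¹), ?_, ?_, ?_⟩
    · refine analyticAt_const.add (Finset.analyticAt_fun_sum _ fun j hj =>
        analyticAt_id.mul (analyticAt_const.mul ?_))
      refine AnalyticAt.fun_inv (by fun_prop) ?_
      rw [add_zero, sub_ne_zero]
      exact fun h => (Finset.ne_of_mem_erase hj) (hx h).symm
    · simp
    · intro w hw
      rw [chart_castSucc]
      refine ⟨by fun_prop, ?_⟩
      rw [deriv_const_add, deriv_id'', mul_one, logCoeff, Finset.mul_sum,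
        ← Finset.add_sum_erase _ _ (Finset.mem_univ i)]
      congr 1
      rw [add_sub_cancel_left]
      field_simp

/-- The equation `f' + κ f = c` in the coordinate `w` at a puncture. -/
theorem local_equation {a c : Fin (m + 3) → ℂ} {i : Fin (m + 3)} {f : ℂ → ℂ} {w A C : ℂ}
    (hd : DifferentiableAt ℂ (chart x i) w)
    (hA : w * deriv (chart x i) w * logCoeff x a (chart x i w) = A)
    (hC : w * deriv (chart x i) w * logCoeff x c (chart x i w) = C)
    (hf : HasDerivAt f (logCoeff x c (chart x i w) - logCoeff x a (chart x i w) *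
      f (chart x i w)) (chart x i w)) :
    DifferentiableAt ℂ (fun w => f (chart x i w)) w ∧
      w * deriv (fun w => f (chart x i w)) w + A * f (chart x i w) = C := by
  have h := HasDerivAt.comp w hf hd.hasDerivAt
  refine ⟨h.differentiableAt, ?_⟩
  have h' : deriv (fun w => f (chart x i w)) w = _ := h.deriv
  rw [h', ← hA, ← hC]
  ring

/-- The value at a puncture of a holomorphic local solution of `∇_κ f = c`. -/
theorem residue_mul_value (hx : Function.Injective (pts x)) {a c : Fin (m + 3) → ℂ}
    (ha : ∑ i, a i = 0) (hc : ∑ i, c i = 0) {i : Fin (m + 3)} {f g : ℂ → ℂ}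
    (hf : ∀ᶠ w in 𝓝[≠] 0, HasDerivAt f (logCoeff x c (chart x i w) -
      logCoeff x a (chart x i w) * f (chart x i w)) (chart x i w))
    (hg : AnalyticAt ℂ g 0) (hfg : ∀ᶠ w in 𝓝[≠] 0, f (chart x i w) = g w) :
    a i * g 0 = c i := by
  obtain ⟨A, hA, hA0, hAe⟩ := exists_localCoeff hx ha i
  obtain ⟨C, hC, hC0, hCe⟩ := exists_localCoeff hx hc i
  rw [← hA0, ← hC0]
  refine residue_mul_eq hA hC hg ?_
  filter_upwards [hf, eventually_eventually_nhdsWithin.mpr hfg, hfg, self_mem_nhdsWithin]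
    with w h1 h2 h3 h4
  rw [isOpen_compl_singleton.nhdsWithin_eq h4] at h2
  have h5 := (local_equation (hAe w h4).1 (hAe w h4).2 (hCe w h4).2 h1).2
  rwa [EventuallyEq.deriv_eq h2, h3] at h5

/-- A function on `T` that is holomorphic at the punctures, extended to the Riemann sphere. -/
theorem exists_extension (hx : Function.Injective (pts x)) {f : E0 (fiber x)}
    (hf : HolAtPunctures x f) :
    ∃ F : ℂ → ℂ, ContDiff ℝ ∞ F ∧ (∀ z ∈ fiber x, F =ᶠ[𝓝 z] f.1) ∧
      (∀ i, AnalyticAt ℂ F (pts x i)) ∧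
      ∃ g : ℂ → ℂ, AnalyticAt ℂ g 0 ∧ ∀ᶠ z in cocompact ℂ, F z = g z⁻¹ := by
  classical
  obtain ⟨h1, g', hg', hg'e⟩ := hf
  choose g hg hge using h1
  set F : ℂ → ℂ := fun z => if h : ∃ i, pts x i = z then g h.choose z else f.1 z with hF
  have hFT : ∀ z ∈ fiber x, F z = f.1 z := fun z hz => dif_neg hz
  have hFT' : ∀ z ∈ fiber x, F =ᶠ[𝓝 z] f.1 := fun z hz => by
    filter_upwards [(fiber x).isOpen.mem_nhds hz] with w hw using hFT w hw
  have hFp : ∀ i, F (pts x i) = g i (pts x i) := fun i => by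
    have h : ∃ j, pts x j = pts x i := ⟨i, rfl⟩
    have : F (pts x i) = g h.choose (pts x i) := dif_pos h
    rw [this, hx h.choose_spec]
  have hFa : ∀ i, AnalyticAt ℂ F (pts x i) := fun i => by
    refine (hg i).congr ?_
    have h2 := (eventually_chart_castSucc (x := x) i).mp (eventually_chart_mem i.castSucc)
    have h3 : ∀ᶠ z in 𝓝[≠] (pts x i), g i z = F z := by
      filter_upwards [h2, hge i] with z hz hz'
      rw [hFT z hz, hz']
    rw [eventually_nhdsWithin_iff] at h3
    filter_upwards [h3] with z hz
    by_cases hzi : z = pts x i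
    · rw [hzi, hFp]
    · exact hz hzi
  refine ⟨F, contDiff_iff_contDiffAt.mpr fun z => ?_, hFT', hFa, g', hg', ?_⟩
  · by_cases hz : z ∈ fiber x
    · exact (f.2.1.contDiffAt ((fiber x).isOpen.mem_nhds hz)).congr_of_eventuallyEq (hFT' z hz)
    · rw [mem_fiber] at hz
      push Not at hz
      obtain ⟨i, rfl⟩ := hz
      exact (hFa i).contDiffAt.restrict_scalars ℝ
  · filter_upwards [hg'e, eventually_chart_last.mp (eventually_chart_mem (x := x) (Fin.last _))]
      with z h h'
    rw [hFT z h', h]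

theorem tendsto_cocompact_of_analyticAt_inv {F g : ℂ → ℂ} (hg : AnalyticAt ℂ g 0)
    (h : ∀ᶠ z in cocompact ℂ, F z = g z⁻¹) : Tendsto F (cocompact ℂ) (𝓝 (g 0)) := by
  refine Tendsto.congr' (h.mono fun z hz => hz.symm) (hg.continuousAt.tendsto.comp ?_)
  rw [← Metric.cobounded_eq_cocompact]
  exact tendsto_inv₀_cobounded

/-! ### Non-exactness of logarithmic forms -/

/-- If `∇_κ f = c` with `f` holomorphic at the punctures, then `f` is constant by Liouville's
theorem, so `c` is proportional to `κ`; a puncture where `c` has no residue and `κ` has one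
forces `c = 0`. -/
theorem residue_eq_zero_of_exact (hx : Function.Injective (pts x)) {a c : Fin (m + 3) → ℂ}
    (ha : ∑ i, a i = 0) (hc : ∑ i, c i = 0) {p : Fin (m + 3)} (hap : a p ≠ 0) (hcp : c p = 0)
    {f : E0 (fiber x)} (hf : HolAtPunctures x f)
    (h : nabla0 (connForm x a) f = connForm x c) (i : Fin (m + 3)) : c i = 0 := by
  have hd : ∀ z ∈ fiber x, HasDerivAt f.1 (logCoeff x c z - logCoeff x a z * f.1 z) z :=
    fun z hz => (nabla0_apply_eq_iff a c f hz).mp (by rw [h])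
  obtain ⟨F, -, hFT, hFa, g, hg, hge⟩ := exists_extension hx hf
  have hFd : Differentiable ℂ F := fun z => by
    by_cases hz : z ∈ fiber x
    · exact ((hd z hz).congr_of_eventuallyEq (hFT z hz)).differentiableAt
    · rw [mem_fiber] at hz
      push Not at hz
      obtain ⟨i, rfl⟩ := hz
      exact (hFa i).differentiableAt
  have hconst : ∀ z, F z = g 0 := fun z =>
    hFd.apply_eq_of_tendsto_cocompact z (tendsto_cocompact_of_analyticAt_inv hg hge)
  have hres : ∀ i, a i * g 0 = c i := fun i =>
    residue_mul_value hx ha hc (f := f.1) (g := fun _ => g 0)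
      ((eventually_chart_mem i).mono fun w hw => hd _ hw) analyticAt_const
      ((eventually_chart_mem i).mono fun w hw => by
        rw [← (hFT _ hw).eq_of_nhds, hconst])
  have h0 : g 0 = 0 := (mul_eq_zero.mp ((hres p).trans hcp)).resolve_left hap
  rw [← hres i, h0, mul_zero]

/-- If no `a i` is a positive integer, every smooth solution of `∇_κ f = c` is holomorphic at the
punctures. -/
theorem holAtPunctures_of_exact (hx : Function.Injective (pts x)) {a c : Fin (m + 3) → ℂ}
    (ha : ∑ i, a i = 0) (hc : ∑ i, c i = 0) (han : ∀ i (n : ℕ), a i ≠ (n : ℂ) + 1)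
    {f : E0 (fiber x)} (h : nabla0 (connForm x a) f = connForm x c) : HolAtPunctures x f := by
  refine holAtPunctures_iff.mpr fun i => ?_
  obtain ⟨A, hA, hA0, hAe⟩ := exists_localCoeff hx ha i
  obtain ⟨C, hC, -, hCe⟩ := exists_localCoeff hx hc i
  refine exists_analyticAt_of_solution (f := fun w => f.1 (chart x i w)) hA hC
    (fun n => hA0 ▸ han i n) ?_
  filter_upwards [eventually_chart_mem i, self_mem_nhdsWithin] with w h1 h2
  exact local_equation (hAe w h2).1 (hAe w h2).2 (hCe w h2).2
    ((nabla0_apply_eq_iff a c f h1).mp (by rw [h]))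

end

/-! ### Compactly supported forms and Stokes' theorem -/

section

variable {T : Opens ℂ} {V : Type} [NormedAddCommGroup V] [NormedSpace ℝ V] [NormedSpace ℂ V]
  [SMulCommClass ℝ ℂ V]

/-- An element of `Smooth T V` with compact support in `T` is smooth on the whole plane. -/
theorem SmoothC.contDiff {η : Smooth T V} (hη : η ∈ SmoothC T V) : ContDiff ℝ ∞ η.1 := by
  obtain ⟨K, hK, hKT, h⟩ := hη
  refine contDiff_iff_contDiffAt.mpr fun z => ?_
  by_cases hz : z ∈ T
  · exact η.2.1.contDiffAt (T.isOpen.mem_nhds hz)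
  · have hzK : z ∉ K := fun hzK => hz (hKT hzK)
    refine (contDiffAt_const (c := (0 : V))).congr_of_eventuallyEq ?_
    filter_upwards [hK.isClosed.isOpen_compl.mem_nhds hzK] with w hw using h w hw

theorem SmoothC.hasCompactSupport {η : Smooth T V} (hη : η ∈ SmoothC T V) :
    HasCompactSupport η.1 := by
  obtain ⟨K, hK, -, h⟩ := hη
  exact HasCompactSupport.intro hK fun z hz => h z hz

end

section

variable {T : Opens ℂ}

theorem nabla0_apply (κ : E1 T) (f : E0 T) {z : ℂ} (hz : z ∈ T) :
    (nabla0 κ f).1 z = d0 f.1 z + f.1 z • κ.1 z := by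
  simp [nabla0, nabla0Fun, hz]

theorem nabla1_apply (κ η : E1 T) {z : ℂ} (hz : z ∈ T) :
    (nabla1 κ η).1 z = d1 η.1 z + wedge (κ.1 z) (η.1 z) := by
  simp [nabla1, nabla1Fun, hz]

/-- Stokes' theorem for a compactly supported form. -/
theorem integral_d1_eq_zero {η : E1 T} (hη : η ∈ E1c T) : ∫ z, d1 η.1 z = 0 := by
  have hc : ContDiff ℝ 1 η.1 := (SmoothC.contDiff hη).of_le (by simp)
  have hs := SmoothC.hasCompactSupport hη
  have hc1 : ContDiff ℝ 1 fun z => (η.1 z).1 := contDiff_fst.comp hc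
  have hc2 : ContDiff ℝ 1 fun z => (η.1 z).2 := contDiff_snd.comp hc
  have hs1 : HasCompactSupport fun z => (η.1 z).1 := hs.comp_left (g := Prod.fst) rfl
  have hs2 : HasCompactSupport fun z => (η.1 z).2 := hs.comp_left (g := Prod.snd) rfl
  have hd : ∀ z, d1 η.1 z = fderiv ℝ (fun z => (η.1 z).2) z 1 -
      fderiv ℝ (fun z => (η.1 z).1) z Complex.I := fun z => by
    have h := (hc.differentiable (by simp) z)
    rw [d1, fderiv.fst h, fderiv.snd h]
    rfl
  have hi : ∀ {F : ℂ → ℂ} (v : ℂ), ContDiff ℝ 1 F → HasCompactSupport F →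
      Integrable fun z => fderiv ℝ F z v := fun v h h' =>
    ((h.continuous_fderiv (by simp)).clm_apply continuous_const).integrable_of_hasCompactSupport
      (h'.fderiv_apply ℝ v)
  simp only [hd]
  rw [integral_sub (hi 1 hc2 hs2) (hi Complex.I hc1 hs1), integral_fderiv_apply_eq_zero hc2 hs2,
    integral_fderiv_apply_eq_zero hc1 hs1, sub_zero]

theorem pairing_eq_integral (ξ η : E1 T) : pairing ξ η = ∫ z, wedge (ξ.1 z) (η.1 z) :=
  setIntegral_eq_integral_of_forall_compl_eq_zero fun z hz => by
    simp [wedge, ξ.2.2 z hz, η.2.2 z hz]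

theorem pairing_comm (ξ η : E1 T) : pairing ξ η = -pairing η ξ := by
  rw [pairing, pairing, ← integral_neg]
  congr 1
  funext z
  simp only [wedge]
  ring

/-- The product of a function and a form. -/
def smulForm (k : E0 T) (η : E1 T) : E1 T :=
  .mk (fun z => k.1 z • η.1 z) (k.2.1.smul η.2.1) fun z hz => by simp [k.2.2 z hz]

/-- `∫ (∇_{-κ} k) ∧ η = ∫ d(k η) = 0` for a `∇_κ`-closed form `η` such that `k η` has compact
support. -/
theorem pairing_nabla0_eq_zero {κ η : E1 T} (hη : η ∈ Z1 κ) {k : E0 T}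
    (hk : smulForm k η ∈ E1c T) : pairing (nabla0 (-κ) k) η = 0 := by
  rw [pairing_eq_integral, ← integral_d1_eq_zero hk]
  congr 1
  funext z
  by_cases hz : z ∈ T
  · have h1 : d1 η.1 z + wedge (κ.1 z) (η.1 z) = 0 := by
      rw [← nabla1_apply κ η hz, LinearMap.mem_ker.mp hη]; rfl
    have h2 : HasFDerivAt (fun z => k.1 z • η.1 z) _ z :=
      (k.differentiableAt hz).hasFDerivAt.smul (η.differentiableAt hz).hasFDerivAt
    have h3 : d1 (smulForm k η).1 z = k.1 z * d1 η.1 z + wedge (d0 k.1 z) (η.1 z) := by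
      rw [d1, smulForm, Smooth.mk_val, h2.fderiv]
      simp [d1, wedge, d0]
      ring
    have h4 : (-κ : E1 T).1 z = -(κ.1 z) := rfl
    rw [h3, nabla0_apply _ _ hz, h4]
    simp only [wedge, d0, Prod.fst_add, Prod.snd_add, Prod.smul_fst, Prod.smul_snd, smul_eq_mul,
      Prod.fst_neg, Prod.snd_neg] at h1 ⊢
    linear_combination -k.1 z * h1
  · obtain ⟨K, hK, hKT, h0⟩ := hk
    have : fderiv ℝ (smulForm k η).1 z = 0 :=
      Smooth.fderiv_eq_zero hK h0 fun hzK => hz (hKT hzK)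
    simp [d1, this, wedge, η.2.2 z hz]

theorem integrable_wedge {ξ : E1 T} (hξ : ξ ∈ E1c T) (η : E1 T) :
    Integrable fun z => wedge (ξ.1 z) (η.1 z) := by
  obtain ⟨K, hK, hKT, h0⟩ := hξ
  have hs : HasCompactSupport fun z => wedge (ξ.1 z) (η.1 z) :=
    HasCompactSupport.intro hK fun z hz => by simp [wedge, h0 z hz]
  refine Continuous.integrable_of_hasCompactSupport ?_ hs
  have hξc := (SmoothC.contDiff ⟨K, hK, hKT, h0⟩ : ContDiff ℝ ∞ ξ.1).continuous
  refine continuous_iff_continuousAt.mpr fun z => ?_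
  by_cases hz : z ∈ T
  · have hηc : ContinuousAt η.1 z := (η.differentiableAt hz).continuousAt
    have := hξc.continuousAt (x := z)
    unfold wedge
    fun_prop
  · refine (continuousAt_const (y := (0 : ℂ))).congr ?_
    filter_upwards [hK.isClosed.isOpen_compl.mem_nhds fun hzK => hz (hKT hzK)] with w hw
    simp [wedge, h0 w hw]

theorem pairing_add_left {ξ ξ' : E1 T} (hξ : ξ ∈ E1c T) (hξ' : ξ' ∈ E1c T) (η : E1 T) :
    pairing (ξ + ξ') η = pairing ξ η + pairing ξ' η := by
  simp only [pairing_eq_integral]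
  rw [← integral_add (integrable_wedge hξ η) (integrable_wedge hξ' η)]
  congr 1
  funext z
  simp only [wedge, Smooth.add_val, Pi.add_apply, Prod.fst_add, Prod.snd_add]
  ring

theorem pairing_add_right {ξ : E1 T} (hξ : ξ ∈ E1c T) (η η' : E1 T) :
    pairing ξ (η + η') = pairing ξ η + pairing ξ η' := by
  simp only [pairing_eq_integral]
  rw [← integral_add (integrable_wedge hξ η) (integrable_wedge hξ η')]
  congr 1
  funext z
  simp only [wedge, Smooth.add_val, Pi.add_apply, Prod.fst_add, Prod.snd_add]
  ring

/-- The intersection pairing depends only on the cohomology classes. -/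
theorem pairing_congr {κ κ' : E1 T} (hκ : κ' = -κ) {ξ ψ : Z1c κ} {η φ : Z1 κ'}
    (hξ : clsC ξ = clsC ψ) (hη : cls η = cls φ) :
    pairing ξ.1.1 η.1 = pairing ψ.1.1 φ.1 := by
  subst hκ
  obtain ⟨h, hh⟩ : ξ - ψ ∈ B1c κ := (Submodule.Quotient.eq _).mp hξ
  obtain ⟨k, hk⟩ : η - φ ∈ B1 (-κ) := (Submodule.Quotient.eq _).mp hη
  have hξ' : (ξ.1.1 : E1 T) = ψ.1.1 + nabla0 κ h.1 := by
    have : nabla0 κ h.1 = ξ.1.1 - ψ.1.1 := congrArg Subtype.val hh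
    rw [this]; abel
  have hη' : η.1 = φ.1 + nabla0 (-κ) k := by
    have : nabla0 (-κ) k = η.1 - φ.1 := hk
    rw [this]; abel
  have hψ : (ψ.1.1 : E1 T) ∈ Z1 κ := (inclZ κ ψ).2
  have h1 : pairing (nabla0 κ h.1) η.1 = 0 := by
    have := pairing_nabla0_eq_zero (κ := -κ) (η := η.1) η.2 (k := h.1) ?_
    · rwa [neg_neg] at this
    · obtain ⟨K, hK, hKT, h0⟩ := h.2
      exact ⟨K, hK, hKT, fun z hz => by simp [smulForm, h0 z hz]⟩
  have h2 : pairing ψ.1.1 (nabla0 (-κ) k) = 0 := by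
    rw [pairing_comm, pairing_nabla0_eq_zero hψ, neg_zero]
    obtain ⟨K, hK, hKT, h0⟩ := ψ.1.2
    exact ⟨K, hK, hKT, fun z hz => by simp [smulForm, h0 z hz]⟩
  calc pairing ξ.1.1 η.1 = pairing ψ.1.1 η.1 + pairing (nabla0 κ h.1) η.1 := by
        rw [hξ', pairing_add_left ψ.1.2 (nabla0_mem κ _ h.2)]
    _ = pairing ψ.1.1 φ.1 := by
        rw [h1, add_zero, hη', pairing_add_right ψ.1.2, h2, add_zero]

/-- `∇_κ ∘ ∇_κ = 0` for a holomorphic form `κ`. -/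
theorem nabla1_nabla0 {κ : E1 T} (hκ : κ ∈ holForms T) (f : E0 T) :
    nabla1 κ (nabla0 κ f) = 0 := by
  obtain ⟨g, hg, rfl⟩ := hκ
  ext1 z
  by_cases hz : z ∈ T
  · have hgz : HasFDerivAt g (ContinuousLinearMap.toSpanSingleton ℂ (deriv g z)) z :=
      (hg.differentiableAt (T.isOpen.mem_nhds hz)).hasDerivAt.hasFDerivAt
    have hgz := hgz.restrictScalars ℝ
    have hf2 : HasFDerivAt (fderiv ℝ f.1) (fderiv ℝ (fderiv ℝ f.1) z) z :=
      ((f.contDiffOn_fderiv.differentiableOn (by simp)).differentiableAt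
        (T.isOpen.mem_nhds hz)).hasFDerivAt
    have hfz := (f.differentiableAt hz).hasFDerivAt
    have hsymm : fderiv ℝ (fderiv ℝ f.1) z 1 Complex.I = fderiv ℝ (fderiv ℝ f.1) z Complex.I 1 :=
      ((f.2.1.contDiffAt (T.isOpen.mem_nhds hz)).isSymmSndFDerivAt
        (by simpa using WithTop.coe_le_coe.mpr (le_top : (2 : ℕ∞) ≤ ⊤))) 1 Complex.I
    have h0 : (nabla0 (holForm g hg) f).1 =ᶠ[𝓝 z] fun w =>
        (fderiv ℝ f.1 w 1 + f.1 w * g w, fderiv ℝ f.1 w Complex.I + f.1 w * (g w * Complex.I)) := by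
      filter_upwards [T.isOpen.mem_nhds hz] with w hw
      rw [nabla0_apply _ _ hw]
      simp [holForm, show w ∈ T from hw, d0]
    have h1 := ((hf2.clm_apply (hasFDerivAt_const (1 : ℂ) z)).add (hfz.mul hgz)).prodMk
      ((hf2.clm_apply (hasFDerivAt_const Complex.I z)).add (hfz.mul (hgz.mul_const Complex.I)))
    rw [nabla1_apply _ _ hz, d1, (h1.congr_of_eventuallyEq h0).fderiv, h0.eq_of_nhds]
    simp [holForm, hz, wedge, hsymm]
    ring
  · exact (nabla1 _ _).2.2 z hz

end

/-! ### Compact representatives -/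

section

variable {m : ℕ} {x : Fin m → ℂ}

/-- Compact support in `T` means vanishing near all the punctures. -/
theorem mem_smoothC_iff {V : Type} [NormedAddCommGroup V] [NormedSpace ℝ V] [NormedSpace ℂ V]
    [SMulCommClass ℝ ℂ V] {η : Smooth (fiber x) V} : η ∈ SmoothC (fiber x) V ↔
      ∀ i, ∀ᶠ w in 𝓝[≠] 0, η.1 (chart x i w) = 0 := by
  constructor
  · rintro ⟨K, hK, hKT, h⟩ i
    induction i using Fin.lastCases with
    | last =>
      refine (eventually_chart_last (P := fun z => η.1 z = 0)).mpr ?_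
      filter_upwards [hK.compl_mem_cocompact] with z hz using h z hz
    | cast i =>
      refine (eventually_chart_castSucc (P := fun z => η.1 z = 0) i).mpr ?_
      refine nhdsWithin_le_nhds ?_
      filter_upwards [hK.isClosed.isOpen_compl.mem_nhds fun hi => pts_notMem_fiber i (hKT hi)]
        with z hz using h z hz
  · intro h
    obtain ⟨K₀, hK₀, h₀⟩ := mem_cocompact.mp
      ((eventually_chart_last (P := fun z => η.1 z = 0)).mp (h (Fin.last _)))
    refine ⟨K₀ ∩ (interior {z | η.1 z = 0})ᶜ, hK₀.inter_right isOpen_interior.isClosed_compl,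
      ?_, ?_⟩
    · rintro z ⟨-, hz⟩
      rw [SetLike.mem_coe, mem_fiber]
      rintro i rfl
      refine hz (mem_interior_iff_mem_nhds.mpr ?_)
      have h1 := (eventually_chart_castSucc (P := fun z => η.1 z = 0) i).mp (h i.castSucc)
      filter_upwards [eventually_nhdsWithin_iff.mp h1] with z hz
      by_cases hzi : z = pts x i
      · exact hzi ▸ η.2.2 _ (pts_notMem_fiber i)
      · exact hz hzi
    · intro z hz
      rw [Set.mem_inter_iff, not_and_or, Set.notMem_compl_iff] at hz
      rcases hz with hz | hz
      · exact h₀ hz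
      · exact (interior_subset hz : z ∈ {z | η.1 z = 0})

/-- The inverse of `chart x i`. -/
def chartInv (x : Fin m → ℂ) (i : Fin (m + 3)) : ℂ → ℂ :=
  Fin.lastCases (motive := fun _ => ℂ → ℂ) (fun z => z⁻¹) (fun i z => z - pts x i) i

theorem chartInv_last : chartInv x (Fin.last (m + 2)) = fun z => z⁻¹ := by
  simp [chartInv]

theorem chartInv_castSucc (i : Fin (m + 2)) : chartInv x i.castSucc = fun z => z - pts x i := by
  simp [chartInv]

theorem chart_chartInv (i : Fin (m + 3)) (z : ℂ) : chart x i (chartInv x i z) = z := by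
  induction i using Fin.lastCases with
  | last => simp [chartInv_last]
  | cast i => simp [chartInv_castSucc]

theorem chartInv_chart (i : Fin (m + 3)) (w : ℂ) : chartInv x i (chart x i w) = w := by
  induction i using Fin.lastCases with
  | last => simp [chartInv_last]
  | cast i => simp [chartInv_castSucc]

theorem hasDerivAt_chartInv (i : Fin (m + 3)) {w : ℂ} (hw : w ≠ 0) :
    deriv (chart x i) w ≠ 0 ∧
      HasDerivAt (chartInv x i) (deriv (chart x i) w)⁻¹ (chart x i w) := by
  induction i using Fin.lastCases with
  | last =>
    rw [chart_last, chartInv_last, deriv_inv]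
    refine ⟨by simpa using hw, ?_⟩
    have := hasDerivAt_inv (inv_ne_zero hw)
    simpa [inv_neg] using this
  | cast i =>
    rw [chart_castSucc, chartInv_castSucc, deriv_const_add, deriv_id'']
    exact ⟨one_ne_zero, by simpa using (hasDerivAt_id (pts x i + w)).sub_const (pts x i)⟩

/-- A smooth function on `T` with prescribed holomorphic germ at one puncture that vanishes near all
the others. -/
theorem exists_glue (hx : Function.Injective (pts x)) {s : ℂ → ℂ} (hs : AnalyticAt ℂ s 0)
    (i : Fin (m + 3)) : ∃ f : E0 (fiber x), ∀ j, ∀ᶠ w in 𝓝[≠] 0,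
      f.1 (chart x j w) = if j = i then s w else 0 := by
  classical
  -- a cutoff `χ` that is `1` near the puncture, with the germ smooth on the support of `χ` in `T`
  obtain ⟨χ, hχ, h1, h0, hor⟩ : ∃ χ : ℂ → ℝ, ContDiff ℝ ∞ χ ∧
      (∀ᶠ w in 𝓝[≠] 0, χ (chart x i w) = 1) ∧
      (∀ j ≠ i, ∀ᶠ w in 𝓝[≠] 0, χ (chart x j w) = 0) ∧
      ∀ z ∈ fiber x, χ =ᶠ[𝓝 z] 0 ∨ ContDiffAt ℝ ∞ (fun z => s (chartInv x i z)) z := by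
    induction i using Fin.lastCases with
    | last =>
      have h1 := (eventually_chart_last (x := x) (P := fun z => z ∈ fiber x)).mp
        (eventually_chart_mem _)
      have h2 : ∀ᶠ z in cocompact ℂ, AnalyticAt ℂ s z⁻¹ := by
        rw [← Metric.cobounded_eq_cocompact]
        exact tendsto_inv₀_cobounded.eventually hs.eventually_analyticAt
      have h3 := h1.and h2
      rw [← Metric.cobounded_eq_cocompact, ← comap_norm_atTop, eventually_comap] at h3
      obtain ⟨R, hR⟩ := eventually_atTop.mp h3
      have hR1 : 0 < max R 1 := lt_max_of_lt_right one_pos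
      let b : ContDiffBump (0 : ℂ) := ⟨max R 1, max R 1 + 1, hR1, by linarith⟩
      have hb1 : ∀ z, ‖z‖ < max R 1 → (fun z => 1 - b z) =ᶠ[𝓝 z] 0 := fun z hz => by
        filter_upwards [Metric.isOpen_ball.mem_nhds (mem_ball_zero_iff.mpr hz)] with u hu
        simp [b.one_of_mem_closedBall (Metric.ball_subset_closedBall hu)]
      refine ⟨fun z => 1 - b z, contDiff_const.sub b.contDiff, ?_, ?_, ?_⟩
      · refine (eventually_chart_last (P := fun z => 1 - b z = 1)).mpr ?_
        filter_upwards [(isCompact_closedBall (0 : ℂ) (max R 1 + 1)).compl_mem_cocompact] with z hz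
        have : max R 1 + 1 ≤ dist z 0 := by
          rw [Set.mem_compl_iff, Metric.mem_closedBall, not_le] at hz; exact hz.le
        simp [b.zero_of_le_dist this]
      · intro j hj
        obtain ⟨j, rfl⟩ := Fin.exists_castSucc_eq.mpr hj
        refine (eventually_chart_castSucc (P := fun z => 1 - b z = 0) j).mpr ?_
        refine nhdsWithin_le_nhds (hb1 _ (lt_of_lt_of_le ?_ (le_max_left R 1)))
        by_contra hlt
        exact pts_notMem_fiber j (hR _ (not_lt.mp hlt) _ rfl).1
      · intro z _
        by_cases hz : ‖z‖ < max R 1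
        · exact Or.inl (hb1 z hz)
        · right
          rw [not_lt] at hz
          have hz0 : z ≠ 0 := norm_pos_iff.mp (hR1.trans_le hz)
          rw [chartInv_last]
          have := (hR _ ((le_max_left R 1).trans hz) z rfl).2
          exact (this.fun_comp (analyticAt_inv hz0)).contDiffAt.restrict_scalars ℝ
    | cast i =>
      have h1 : ∀ᶠ z in 𝓝 (pts x i), AnalyticAt ℂ s (z - pts x i) := by
        have : Tendsto (fun z => z - pts x i) (𝓝 (pts x i)) (𝓝 0) := by
          have : ContinuousAt (fun z => z - pts x i) (pts x i) := by fun_prop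
          simpa using this.tendsto
        exact this.eventually hs.eventually_analyticAt
      have h2 : ∀ᶠ z in 𝓝 (pts x i), ∀ j ≠ i, z ≠ pts x j := by
        refine eventually_all.mpr fun j => ?_
        by_cases hj : j = i
        · simp [hj]
        · filter_upwards [isOpen_ne.mem_nhds (hx.ne (Ne.symm hj))] with z hz _ using hz
      obtain ⟨ε, hε, hball⟩ := Metric.eventually_nhds_iff_ball.mp (h1.and h2)
      let b : ContDiffBump (pts x i) := ⟨ε / 3, ε / 2, by positivity, by linarith⟩
      have hb0 : ∀ z, ε / 2 < dist z (pts x i) → (fun z => b z) =ᶠ[𝓝 z] 0 := fun z hz => by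
        filter_upwards [Metric.isClosed_closedBall.isOpen_compl.mem_nhds
          (show z ∈ (Metric.closedBall (pts x i) (ε / 2))ᶜ by simpa using hz)] with u hu
        refine b.zero_of_le_dist ?_
        rw [Set.mem_compl_iff, Metric.mem_closedBall, not_le] at hu
        exact hu.le
      refine ⟨fun z => b z, b.contDiff, ?_, ?_, ?_⟩
      · refine (eventually_chart_castSucc (P := fun z => b z = 1) i).mpr ?_
        exact nhdsWithin_le_nhds b.eventuallyEq_one
      · intro j hj
        induction j using Fin.lastCases with
        | last =>
          refine (eventually_chart_last (P := fun z => b z = 0)).mpr ?_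
          filter_upwards [(isCompact_closedBall (pts x i) (ε / 2)).compl_mem_cocompact] with z hz
          rw [Set.mem_compl_iff, Metric.mem_closedBall, not_le] at hz
          exact b.zero_of_le_dist hz.le
        | cast j =>
          refine (eventually_chart_castSucc (P := fun z => b z = 0) j).mpr ?_
          refine nhdsWithin_le_nhds (hb0 _ ?_)
          by_contra hlt
          have hmem : pts x j ∈ Metric.ball (pts x i) ε := by
            rw [Metric.mem_ball]; linarith [not_lt.mp hlt]
          exact (hball _ hmem).2 j (fun h => hj (by rw [h])) rfl
      · intro z _
        by_cases hz : z ∈ Metric.ball (pts x i) ε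
        · right
          rw [chartInv_castSucc]
          have : AnalyticAt ℂ (fun z => s (z - pts x i)) z :=
            AnalyticAt.fun_comp (hball z hz).1 (by fun_prop)
          exact this.contDiffAt.restrict_scalars ℝ
        · left
          rw [Metric.mem_ball, not_lt] at hz
          exact hb0 z (by linarith)
  refine ⟨.mk (((fiber x : Opens ℂ) : Set ℂ).indicator
    fun z => (χ z : ℂ) * s (chartInv x i z)) ?_ fun z hz => Set.indicator_of_notMem hz _, ?_⟩
  · refine ContDiffOn.congr (f := fun z => (χ z : ℂ) * s (chartInv x i z)) (fun z hz => ?_)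
      fun z hz => Set.indicator_of_mem hz _
    refine ContDiffAt.contDiffWithinAt ?_
    rcases hor z hz with h | h
    · refine (contDiffAt_const (c := (0 : ℂ))).congr_of_eventuallyEq ?_
      filter_upwards [h] with u hu
      simp [hu]
    · exact ((Complex.ofRealCLM.contDiff.comp hχ).contDiffAt).mul h
  · intro j
    by_cases hj : j = i
    · subst hj
      filter_upwards [h1, eventually_chart_mem (x := x) j] with w hw hwT
      simp [hw, show chart x j w ∈ (fiber x : Set ℂ) from hwT, chartInv_chart]
    · filter_upwards [h0 j hj] with w hw
      simp [hj, Set.indicator, hw]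

theorem Smooth.sum_apply {T : Opens ℂ} {V : Type} [NormedAddCommGroup V] [NormedSpace ℝ V]
    [NormedSpace ℂ V] [SMulCommClass ℝ ℂ V] {ι : Type*} (s : Finset ι) (f : ι → Smooth T V)
    (z : ℂ) : (∑ i ∈ s, f i).1 z = ∑ i ∈ s, (f i).1 z := by
  classical
  induction s using Finset.induction_on with
  | empty => simp
  | insert i s hi ih => simp [Finset.sum_insert hi, ih]

/-- Local holomorphic solutions of `∇_κ f = c` at all the punctures, glued to a smooth function. -/
theorem exists_local_primitive (hx : Function.Injective (pts x)) {a c : Fin (m + 3) → ℂ}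
    (ha : ∑ i, a i = 0) (hc : ∑ i, c i = 0) (han : ∀ i (n : ℕ), a i ≠ -((n : ℂ) + 1))
    (hac : ∀ i, a i = 0 → c i = 0) :
    ∃ f : E0 (fiber x), HolAtPunctures x f ∧
      connForm x c - nabla0 (connForm x a) f ∈ E1c (fiber x) := by
  choose A hA hA0 hAe using exists_localCoeff hx ha
  choose C hC hC0 hCe using exists_localCoeff hx hc
  choose s hs hse using fun i => exists_analyticAt_solution (hA i) (hC i)
    (fun n => (hA0 i).symm ▸ han i n) (by rw [hA0, hC0]; exact hac i)
  choose f hf using fun i => exists_glue hx (hs i) i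
  have hF : ∀ j, ∀ᶠ w in 𝓝[≠] 0, (∑ i, f i).1 (chart x j w) = s j w := fun j => by
    filter_upwards [eventually_all.mpr fun i => hf i j] with w hw
    rw [Smooth.sum_apply, Finset.sum_congr rfl fun i _ => hw i]
    simp
  refine ⟨∑ i, f i, holAtPunctures_iff.mpr fun i => ⟨s i, hs i, hF i⟩,
    mem_smoothC_iff.mpr fun i => ?_⟩
  filter_upwards [eventually_chart_mem i, self_mem_nhdsWithin,
    eventually_eventually_nhdsWithin.mpr (hF i), hF i, nhdsWithin_le_nhds (hse i),
    nhdsWithin_le_nhds (hs i).eventually_analyticAt] with w hwT hw0 hFw hFw' hode hsw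
  have hw0 : w ≠ 0 := hw0
  rw [isOpen_compl_singleton.nhdsWithin_eq hw0] at hFw
  obtain ⟨hD, hinv⟩ := hasDerivAt_chartInv (x := x) i hw0
  have h1 : (∑ i, f i).1 =ᶠ[𝓝 (chart x i w)] fun z => s i (chartInv x i z) := by
    have ht : Tendsto (chartInv x i) (𝓝 (chart x i w)) (𝓝 w) := by
      simpa [chartInv_chart] using hinv.continuousAt.tendsto
    filter_upwards [ht.eventually hFw] with z hz
    rwa [chart_chartInv] at hz
  have h2 : HasDerivAt (fun z => s i (chartInv x i z))
      (deriv (s i) w * (deriv (chart x i) w)⁻¹) (chart x i w) := by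
    refine HasDerivAt.comp (chart x i w) ?_ hinv
    rw [chartInv_chart]
    exact hsw.differentiableAt.hasDerivAt
  have h3 := (nabla0_apply_eq_iff a c (∑ i, f i) hwT).mpr
    ((h2.congr_of_eventuallyEq h1).congr_deriv ?_)
  · change (connForm x c).1 _ - (nabla0 (connForm x a) _).1 _ = 0
    rw [h3, sub_self]
  · rw [hFw']
    rw [← (hAe i w hw0).2, ← (hCe i w hw0).2] at hode
    field_simp
    refine mul_left_cancel₀ hw0 ?_
    linear_combination hode

/-! ### The intersection number -/

/-- The residue formula `∫ (c - ∇_κ f) ∧ c = 2πi ∑ cᵢ f(xᵢ)`, where the values of `f` at the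
punctures are determined by `aᵢ f(xᵢ) = cᵢ`. -/
theorem exists_pairing_eq (hx : Function.Injective (pts x)) {a c : Fin (m + 3) → ℂ}
    (ha : ∑ i, a i = 0) (hc : ∑ i, c i = 0) {f : E0 (fiber x)} (hf : HolAtPunctures x f)
    (hψ : connForm x c - nabla0 (connForm x a) f ∈ E1c (fiber x)) :
    ∃ v : Fin (m + 3) → ℂ, (∀ i, a i * v i = c i) ∧
      pairing (connForm x c - nabla0 (connForm x a) f) (connForm x c) =
        2 * Real.pi * Complex.I * ∑ i, c i * v i := by
  obtain ⟨F, hF, hFT, hFa, g, hg, hge⟩ := exists_extension hx hf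
  have hode : ∀ i, ∀ᶠ w in 𝓝[≠] 0, HasDerivAt f.1 (logCoeff x c (chart x i w) -
      logCoeff x a (chart x i w) * f.1 (chart x i w)) (chart x i w) := fun i => by
    filter_upwards [mem_smoothC_iff.mp hψ i, eventually_chart_mem i] with w h1 h2
    exact (nabla0_apply_eq_iff a c f h2).mp (sub_eq_zero.mp h1).symm
  have hF1 : ContDiff ℝ 1 F := hF.of_le (by simp)
  have hL := tendsto_cocompact_of_analyticAt_inv hg hge
  have hdc : ∀ᶠ z in cocompact ℂ, dbar F z = 0 := by
    have h1 := (eventually_chart_last (x := x)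
      (P := fun z => HasDerivAt f.1 (logCoeff x c z - logCoeff x a z * f.1 z) z)).mp (hode _)
    have h2 := (eventually_chart_last (x := x) (P := fun z => z ∈ fiber x)).mp
      (eventually_chart_mem _)
    filter_upwards [h1, h2] with z h1 h2
    rw [(hFT z h2).dbar_eq, h1.dbar_eq_zero]
  have hdp : ∀ i, ∀ᶠ z in 𝓝 (pts x i), dbar F z = 0 := fun i => by
    filter_upwards [(hFa i).eventually_analyticAt] with z hz
    exact hz.differentiableAt.hasDerivAt.dbar_eq_zero
  have hint : ∀ i, Integrable fun z => dbar F z * (z - pts x i)⁻¹ := fun i => by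
    obtain ⟨K, hK, hK0⟩ := mem_cocompact.mp hdc
    refine Continuous.integrable_of_hasCompactSupport (continuous_iff_continuousAt.mpr fun z => ?_)
      (HasCompactSupport.intro hK fun z hz => by rw [show dbar F z = 0 from hK0 hz, zero_mul])
    by_cases hz : z = pts x i
    · refine (continuousAt_const (y := (0 : ℂ))).congr ?_
      rw [hz]
      filter_upwards [hdp i] with u hu
      rw [hu, zero_mul]
    · exact (continuous_dbar hF1).continuousAt.mul
        ((continuousAt_id.sub continuousAt_const).inv₀ (sub_ne_zero.mpr hz))
  refine ⟨Fin.snoc (α := fun _ => ℂ) (fun i => F (pts x i)) (g 0), ?_, ?_⟩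
  · rw [Fin.forall_fin_succ']
    refine ⟨fun i => ?_, ?_⟩
    · have := residue_mul_value hx ha hc (hode i.castSucc) (g := fun w => F (pts x i + w))
        (AnalyticAt.fun_comp (by simpa using hFa i) (by fun_prop)) ?_
      · simpa using this
      · filter_upwards [eventually_chart_mem i.castSucc] with w hw
        rw [← (hFT _ hw).eq_of_nhds]
        simp
    · have := residue_mul_value hx ha hc (hode (Fin.last _)) hg ?_
      · simpa using this
      · filter_upwards [eventually_chart_mem (Fin.last _), (eventually_chart_last (x := x)
          (P := fun z => F z = g z⁻¹)).mpr hge] with w hw hw'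
        rw [← (hFT _ hw).eq_of_nhds, hw']
        simp
  · -- `c ∧ c` and `κ ∧ c` vanish, so the integrand is `-df ∧ c`, which only sees `∂f/∂z̄`
    have hpt : ∀ z, wedge ((connForm x c - nabla0 (connForm x a) f : E1 (fiber x)).1 z)
        ((connForm x c).1 z) =
        ∑ i : Fin (m + 2), -Complex.I * c i.castSucc * (dbar F z * (z - pts x i)⁻¹) := fun z => by
      by_cases hz : z ∈ fiber x
      · have h1 : (connForm x c - nabla0 (connForm x a) f : E1 (fiber x)).1 z =
          (connForm x c).1 z - (nabla0 (connForm x a) f).1 z := rfl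
        have h2 : ∑ i : Fin (m + 2), -Complex.I * c i.castSucc * (dbar F z * (z - pts x i)⁻¹) =
            -Complex.I * dbar F z * logCoeff x c z := by
          rw [logCoeff, Finset.mul_sum]
          exact Finset.sum_congr rfl fun i _ => by ring
        rw [h1, h2, nabla0_apply _ _ hz, connForm_apply _ hz, connForm_apply _ hz,
          (hFT z hz).dbar_eq]
        simp only [wedge, d0, dbar, Prod.fst_sub, Prod.snd_sub, Prod.fst_add, Prod.snd_add,
          Prod.smul_mk, smul_eq_mul]
        linear_combination (fderiv ℝ f.1 z Complex.I * logCoeff x c z) * Complex.I_mul_I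
      · rw [(connForm x c).2.2 z hz]
        rw [mem_fiber] at hz
        push Not at hz
        obtain ⟨i, rfl⟩ := hz
        simp [(hdp i).self_of_nhds, wedge]
    rw [pairing_eq_integral]
    simp only [hpt]
    rw [integral_finsetSum _ fun i _ => (hint i).const_mul _]
    simp only [integral_const_mul, integral_dbar_div hF1 hL hdc]
    rw [Fin.sum_univ_castSucc] at hc
    rw [Fin.sum_univ_castSucc (n := m + 2)]
    simp only [Fin.snoc_castSucc, Fin.snoc_last, mul_add, mul_sub, Finset.sum_sub_distrib]
    have e1 : ∑ i : Fin (m + 2), -Complex.I * c i.castSucc * (2 * Real.pi * g 0) =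
        -(2 * Real.pi * Complex.I * g 0) * ∑ i : Fin (m + 2), c i.castSucc := by
      rw [Finset.mul_sum]; exact Finset.sum_congr rfl fun i _ => by ring
    have e2 : ∑ i : Fin (m + 2), -Complex.I * c i.castSucc * (2 * Real.pi * F (pts x i)) =
        -(2 * Real.pi * Complex.I) * ∑ i : Fin (m + 2), c i.castSucc * F (pts x i) := by
      rw [Finset.mul_sum]; exact Finset.sum_congr rfl fun i _ => by ring
    rw [e1, e2]
    linear_combination -(2 * Real.pi * Complex.I * g 0) * hc

end

/-! ### The shifted parameters -/

section

variable {m : ℕ}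

theorem sum_single_sub_single (q r : Fin (m + 3)) :
    ∑ i, (Pi.single q 1 - Pi.single r 1 : Fin (m + 3) → ℂ) i = 0 := by
  simp [Finset.sum_sub_distrib]

theorem sum_shift {α : Fin (m + 3) → ℂ} (hsum : ∑ i, α i = 0) (q r : Fin (m + 3)) :
    ∑ i, shift α q r i = 0 := by
  simp [shift, Finset.sum_add_distrib, Finset.sum_sub_distrib, hsum]

theorem shift_ne_zero {α : Fin (m + 3) → ℂ} {i : Fin (m + 3)} (hi : ∀ n : ℤ, α i ≠ n)
    (q r : Fin (m + 3)) : shift α q r i ≠ 0 := by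
  have hs : ∀ j, (Pi.single j 1 : Fin (m + 3) → ℂ) i = ((if i = j then 1 else 0 : ℤ) : ℂ) :=
    fun j => by rw [Pi.single_apply]; split_ifs <;> simp
  intro h
  refine hi (-((if i = q then 1 else 0) + (if i = r then 1 else 0)
    - (if i = (Fin.last (m + 1)).castSucc then 1 else 0)
    - (if i = Fin.last (m + 2) then 1 else 0))) ?_
  simp only [shift, Pi.add_apply, Pi.sub_apply, hs] at h
  rw [Int.cast_neg, Int.cast_sub, Int.cast_sub, Int.cast_add]
  linear_combination h

end

end TwistedCohomology
end

open TwistedCohomology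

theorem mainTheorem8 (m : ℕ) (x : Fin m → ℂ) (hx : Function.Injective (pts x))
    (α : Fin (m + 3) → ℂ) (hsum : ∑ i, α i = 0)
    (p q r : Fin (m + 3)) (hpq : p ≠ q) (hpr : p ≠ r) (hqr : q ≠ r)
    (hp : ∀ n : ℤ, α p ≠ n) (hq : ∀ n : ℤ, α q ≠ n) (hr : ∀ n : ℤ, α r ≠ n)
    (hadd : α q + α r ≠ 0)
    (hneg : ∀ (i : Fin (m + 3)) (n : ℕ), shift α q r i ≠ -((n : ℂ) + 1)) :
    cls (phiZ x (-shift α q r) q r) ≠ 0 ∧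
    (∃ ψ : Z1c (connForm x (shift α q r)), IsCompactRep x (shift α q r) q r ψ) ∧
    ∀ ψ : Z1c (connForm x (shift α q r)), IsCompactRep x (shift α q r) q r ψ →
      natMap (connForm x (shift α q r)) (clsC ψ) = cls (phiZ x (shift α q r) q r) ∧
      clsC ψ ≠ 0 ∧
      ∀ (ξ : Z1c (connForm x (shift α q r))) (η : Z1 (connForm x (-shift α q r))),
        clsC ξ = clsC ψ → cls η = cls (phiZ x (-shift α q r) q r) →
        pairing ξ.1.1 η.1 = 2 * Real.pi * Complex.I *
          ((shift α q r q + shift α q r r) / (shift α q r q * shift α q r r)) := by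
  have ha := sum_shift hsum q r
  have hap := shift_ne_zero hp q r
  have haq := shift_ne_zero hq q r
  have har := shift_ne_zero hr q r
  generalize shift α q r = a at *
  have hc := sum_single_sub_single q r
  have hφ := phi_eq_connForm (x := x) q r
  have hcp : (Pi.single q 1 - Pi.single r 1 : Fin (m + 3) → ℂ) p = 0 := by simp [hpq, hpr]
  have hcq : (Pi.single q 1 - Pi.single r 1 : Fin (m + 3) → ℂ) q = 1 := by simp [hqr]
  have hcr : (Pi.single q 1 - Pi.single r 1 : Fin (m + 3) → ℂ) r = -1 := by simp [hqr.symm]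
  have hci : ∀ i, i ≠ q → i ≠ r → (Pi.single q 1 - Pi.single r 1 : Fin (m + 3) → ℂ) i = 0 :=
    fun i hiq hir => by simp [hiq, hir]
  generalize (Pi.single q 1 - Pi.single r 1 : Fin (m + 3) → ℂ) = c at *
  refine ⟨fun h => ?_, ?_, ?_⟩
  · obtain ⟨f, hf⟩ := (Submodule.Quotient.mk_eq_zero _).mp h
    have hf : nabla0 (connForm x (-a)) f = connForm x c := hf.trans hφ
    have ha' : ∑ i, (-a) i = 0 := by simp [ha]
    have hhol := holAtPunctures_of_exact hx ha' hc
      (fun i n hi => hneg i n (by rw [← hi]; simp)) hf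
    have := residue_eq_zero_of_exact hx ha' hc (neg_ne_zero.mpr hap) hcp hhol hf q
    exact one_ne_zero (hcq.symm.trans this)
  · obtain ⟨f, hf, hψ⟩ := exists_local_primitive hx ha hc hneg fun i hi =>
      hci i (fun h => haq (h ▸ hi)) fun h => har (h ▸ hi)
    rw [← hφ] at hψ
    refine ⟨⟨⟨_, hψ⟩, LinearMap.mem_ker.mpr (Subtype.ext ?_)⟩, f, hf, rfl⟩
    change nabla1 (connForm x a) (phi x q r - nabla0 (connForm x a) f) = 0
    rw [map_sub, nabla1_nabla0 (connForm_mem x a), sub_zero]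
    exact LinearMap.mem_ker.mp (phiZ x a q r).2
  · rintro ψ ⟨f, hf, hψ⟩
    refine ⟨?_, fun h => ?_, fun ξ η hξ hη => ?_⟩
    · refine (Submodule.Quotient.eq (B1 (connForm x a))).mpr ⟨-f, ?_⟩
      change nabla0 (connForm x a) (-f) = ψ.1.1 - phi x q r
      rw [hψ, map_neg]
      abel
    · obtain ⟨g, hg⟩ := (Submodule.Quotient.mk_eq_zero _).mp h
      have hg : nabla0 (connForm x a) g.1 = phi x q r - nabla0 (connForm x a) f :=
        (congrArg Subtype.val hg).trans hψ
      have hfg : nabla0 (connForm x a) (f + g.1) = connForm x c := by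
        rw [map_add, hg, hφ]
        abel
      -- `g` vanishes near the punctures, so `f + g` is holomorphic there as well
      have hhol : HolAtPunctures x (f + g.1) := holAtPunctures_iff.mpr fun i => by
        obtain ⟨s, hs, hfs⟩ := holAtPunctures_iff.mp hf i
        refine ⟨s, hs, ?_⟩
        filter_upwards [hfs, mem_smoothC_iff.mp g.2 i] with w h1 h2
        rw [Smooth.add_val, Pi.add_apply, h1, h2, add_zero]
      have := residue_eq_zero_of_exact hx ha hc hap hcp hhol hfg q
      exact one_ne_zero (hcq.symm.trans this)
    · rw [pairing_congr (connForm_neg a) hξ hη]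
      change pairing ψ.1.1 (phi x q r) = _
      have hmem : (ψ.1.1 : E1 (fiber x)) ∈ E1c (fiber x) := ψ.1.2
      rw [hψ, hφ] at hmem ⊢
      obtain ⟨v, hv, hpair⟩ := exists_pairing_eq hx ha hc hf hmem
      rw [hpair]
      congr 1
      rw [Finset.sum_eq_add q r hqr (fun i _ hi => by rw [hci i hi.1 hi.2, zero_mul])
        (by simp) (by simp), hcq, hcr]
      have h1 := (hv q).trans hcq
      have h2 := (hv r).trans hcr
      field_simp
      linear_combination a r * h1 - a q * h2
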